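/- Write $\mathbf x^{\perp}=(-x_2,x_1)$ for $\mathbf x=(x_1,x_2)\in\mathbb R^2$. For a bounded open set $U\subset\mathbb R^2$ with area $|U|$, a coupling constant $G>0$ and a mass $M>0$, let $$\mathcal E^{\rm GP}_U[u]=\frac12\int_U\Big(\big|(-\mathrm i\nabla-\mathbf x^{\perp})u\big|^2+G|u|^4\Big)\,d\mathbf x ,$$ and define the Neumann and Dirichlet energies $$E^{\rm GP}(U,M)=\inf\Big\{\mathcal E^{\rm GP}_U[u]:u\in H^1(U;\mathbb C),\ \int_U|u|^2=M\Big\},\qquad E^{\rm GP}_0(U,M)=\inf\Big\{\mathcal E^{\rm GP}_U[u]:u\in H^1_0(U;\mathbb C),\ \int_U|u|^2=M\Big\}.$$ **Theorem 2.1 (Thermodynamic limit for the homogeneous gas).** Let $G>0$ and $\varrho>0$ be fixed. There is a finite number $e^{\rm GP}(\varrho)\ge 0$, depending only on $G$ and $\varrho$, such that for every bounded simply connected domain $\mathcal D\subset\mathbb R^2$ (non-empty, open, connected) with Lipschitz boundary, both of the following limits exist and $$\lim_{L\to\infty}\frac{E^{\rm GP}(L\mathcal D,\varrho|L\mathcal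 D|)}{|L\mathcal D|}=\lim_{L\to\infty}\frac{E^{\rm GP}_0(L\mathcal D,\varrho|L\mathcal D|)}{|L\mathcal D|}=e^{\rm GP}(\varrho).$$ Here $L\to\infty$ through the real numbers and $L\mathcal D=\{L\mathbf x:\mathbf x\in\mathcal D\}$. -/

import Mathlib

open MeasureTheory Filter Topology
open scoped ENNReal NNReal Pointwise ContDiff

/-- The Euclidean plane `ℝ²`. -/
abbrev Plane : Type := EuclideanSpace ℝ (Fin 2)

/-- The rotated vector `x^⊥ = (-x₂, x₁)`. -/
def perp (x : Plane) : Plane := !₂[-x 1, x 0]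

/-- The `j`-th partial derivative of a differentiable function on the plane. -/
noncomputable def partialDeriv {F : Type*} [NormedAddCommGroup F] [NormedSpace ℝ F]
    (j : Fin 2) (f : Plane → F) (x : Plane) : F :=
  fderiv ℝ f x (EuclideanSpace.single j 1)

/-- `φ ∈ C_c^∞(U; F)`: smooth, with compact support contained in `U`. -/
structure IsTestFunction {F : Type*} [NormedAddCommGroup F] [NormedSpace ℝ F]
    (U : Set Plane) (φ : Plane → F) : Prop where
  smooth : ContDiff ℝ ∞ φ
  compact : HasCompactSupport φ
  support_subset : tsupport φ ⊆ U

/-- `u ∈ H¹(U)` with weak gradient `∇u = (g 0, g 1)`: the functions `u`, `g 0`, `g 1` are in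
`L²(U; ℂ)` and `∫_U u ∂_j φ = -∫_U g_j φ` for all test functions `φ ∈ C_c^∞(U)`. The weak gradient
is determined by `u` up to a null set. -/
structure MemH1 (U : Set Plane) (u : Plane → ℂ) (g : Fin 2 → Plane → ℂ) : Prop where
  memLp : MemLp u 2 (volume.restrict U)
  memLp_grad : ∀ j, MemLp (g j) 2 (volume.restrict U)
  weak_grad : ∀ φ : Plane → ℝ, IsTestFunction U φ → ∀ j,
    ∫ x in U, ((partialDeriv j φ x : ℝ) : ℂ) * u x = -∫ x in U, (φ x : ℂ) * g j x

/-- `u ∈ H¹₀(U)` with weak gradient `g`: `u` belongs to the closure of `C_c^∞(U; ℂ)` in `H¹(U)`. -/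
structure MemH10 (U : Set Plane) (u : Plane → ℂ) (g : Fin 2 → Plane → ℂ) : Prop
    extends MemH1 U u g where
  approx : ∃ φ : ℕ → Plane → ℂ, (∀ n, IsTestFunction U (φ n)) ∧
    Tendsto (fun n => eLpNorm (u - φ n) 2 (volume.restrict U)) atTop (𝓝 0) ∧
    ∀ j, Tendsto (fun n => eLpNorm (g j - partialDeriv j (φ n)) 2 (volume.restrict U))
      atTop (𝓝 0)

/-- The magnetic Gross-Pitaevskii functional
`½ ∫_U |(-i∇ - x^⊥) u|² + G |u|⁴ ∈ [0, ∞]`, where `g = ∇u`. -/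
noncomputable def gpFunctional (G : ℝ) (U : Set Plane) (u : Plane → ℂ) (g : Fin 2 → Plane → ℂ) :
    ℝ≥0∞ :=
  ∫⁻ x in U, ENNReal.ofReal
    ((1 / 2) * ((∑ j, ‖-Complex.I * g j x - (perp x j : ℂ) * u x‖ ^ 2) + G * ‖u x‖ ^ 4))

/-- The mass `∫_U |u|²`. -/
noncomputable def mass (U : Set Plane) (u : Plane → ℂ) : ℝ≥0∞ :=
  ∫⁻ x in U, ENNReal.ofReal (‖u x‖ ^ 2)

/-- The Neumann energy: infimum of the functional over `u ∈ H¹(U)` of mass `M`. -/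
noncomputable def neumannEnergy (G : ℝ) (U : Set Plane) (M : ℝ≥0∞) : ℝ≥0∞ :=
  sInf {E | ∃ u g, MemH1 U u g ∧ mass U u = M ∧ E = gpFunctional G U u g}

/-- The Dirichlet energy: infimum of the functional over `u ∈ H¹₀(U)` of mass `M`. -/
noncomputable def dirichletEnergy (G : ℝ) (U : Set Plane) (M : ℝ≥0∞) : ℝ≥0∞ :=
  sInf {E | ∃ u g, MemH10 U u g ∧ mass U u = M ∧ E = gpFunctional G U u g}

/-- `D` has Lipschitz boundary: near each boundary point `p`, in suitable orthonormal
coordinates centred at `p`, the set `D` is the strict epigraph of a Lipschitz function. -/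
def HasLipschitzBoundary (D : Set Plane) : Prop :=
  ∀ p ∈ frontier D, ∃ (b : OrthonormalBasis (Fin 2) ℝ Plane) (r : ℝ) (K : ℝ≥0) (γ : ℝ → ℝ),
    0 < r ∧ LipschitzWith K γ ∧
      ∀ x ∈ Metric.ball p r, x ∈ D ↔ γ (inner ℝ (b 0) (x - p)) < inner ℝ (b 1) (x - p)

open scoped Convolution

/-! ### Test functions -/

namespace IsTestFunction

variable {F : Type*} [NormedAddCommGroup F] [NormedSpace ℝ F] {U V : Set Plane}

/-! The limit is e, the infimum over r > 0 of the Dirichlet energy per unit area of a square of side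
r at density ϱ. Three properties of the Dirichlet energy carry the argument. It is subadditive over
disjoint sets, because H¹₀ functions extend by zero (`dirichletEnergy_add_le`). It does not change
when a square is translated, because a gauge phase compensates the shift of x^⊥
(`dirichletEnergy_translate_le`). Multiplying the mass by c ≥ 1 multiplies the energy by at most c²
(`dirichletEnergy_mul_le`), so a small mass mismatch costs only a factor close to 1.

Dirichlet, upper bound: fill most of LD with fixed squares of nearly optimal side. Lower bound:
enclose D in a square W and fill most of L(W \ closure D) with nearly optimal squares. The big
square LW has energy density at least e and the filling squares have density close to e, so the
share of LD cannot stay below e. The boundary of D matters here only through its area, which is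
zero.

Neumann: this energy is at most the Dirichlet one. Conversely, multiply a near-minimiser on LD by
η(x/L), where η is a fixed cutoff equal to 1 on most of D. The gradient of this factor is O(1/L), so
the localisation error per unit area vanishes. Little mass is lost, because G > 0 lets the energy
control ∫|u|⁴, hence the mass sitting on a small fraction of the area. No boundary-layer estimate
and no minimiser are needed. -/

theorem mono {φ : Plane → F} (h : IsTestFunction U φ) (hUV : U ⊆ V) : IsTestFunction V φ :=
  ⟨h.smooth, h.compact, h.support_subset.trans hUV⟩

theorem zero : IsTestFunction U (0 : Plane → F) :=
  ⟨contDiff_const, HasCompactSupport.zero, by simp [tsupport]⟩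

theorem add {φ ψ : Plane → F} (h : IsTestFunction U φ) (h' : IsTestFunction U ψ) :
    IsTestFunction U (φ + ψ) :=
  ⟨h.smooth.add h'.smooth, h.compact.add h'.compact,
    (tsupport_add φ ψ).trans (Set.union_subset h.support_subset h'.support_subset)⟩

theorem eq_zero {φ : Plane → F} (h : IsTestFunction U φ) {x : Plane} (hx : x ∉ U) : φ x = 0 :=
  image_eq_zero_of_notMem_tsupport fun hx' => hx (h.support_subset hx')

theorem partialDeriv_eq_zero {φ : Plane → F} (h : IsTestFunction U φ) (j : Fin 2) {x : Plane}
    (hx : x ∉ U) : partialDeriv j φ x = 0 := by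
  have : fderiv ℝ φ x = 0 := by
    by_contra hne
    exact hx (h.support_subset (support_fderiv_subset ℝ hne))
  simp [partialDeriv, this]

theorem continuous {φ : Plane → F} (h : IsTestFunction U φ) : Continuous φ := h.smooth.continuous

theorem differentiable {φ : Plane → F} (h : IsTestFunction U φ) : Differentiable ℝ φ :=
  h.smooth.differentiable (by simp)

theorem continuous_partialDeriv {φ : Plane → F} (h : IsTestFunction U φ) (j : Fin 2) :
    Continuous (partialDeriv j φ) :=
  (h.smooth.continuous_fderiv (by simp)).clm_apply continuous_const

theorem hasCompactSupport_partialDeriv {φ : Plane → F} (h : IsTestFunction U φ) (j : Fin 2) :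
    HasCompactSupport (partialDeriv j φ) :=
  h.compact.fderiv_apply (𝕜 := ℝ) _

theorem memLp {φ : Plane → F} (h : IsTestFunction U φ) (p : ℝ≥0∞) (μ : Measure Plane)
    [IsFiniteMeasureOnCompacts μ] : MemLp φ p μ :=
  h.continuous.memLp_of_hasCompactSupport h.compact

theorem memLp_partialDeriv {φ : Plane → F} (h : IsTestFunction U φ) (j : Fin 2) (p : ℝ≥0∞)
    (μ : Measure Plane) [IsFiniteMeasureOnCompacts μ] : MemLp (partialDeriv j φ) p μ :=
  (h.continuous_partialDeriv j).memLp_of_hasCompactSupport (h.hasCompactSupport_partialDeriv j)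

end IsTestFunction

theorem partialDeriv_add {F : Type*} [NormedAddCommGroup F] [NormedSpace ℝ F] {φ ψ : Plane → F}
    (hφ : Differentiable ℝ φ) (hψ : Differentiable ℝ ψ) (j : Fin 2) :
    partialDeriv j (φ + ψ) = partialDeriv j φ + partialDeriv j ψ := by
  ext x
  simp [partialDeriv, fderiv_add (hφ x) (hψ x)]

theorem partialDeriv_mul {𝔸 : Type*} [NormedCommRing 𝔸] [NormedAlgebra ℝ 𝔸] {φ ψ : Plane → 𝔸}
    (hφ : Differentiable ℝ φ) (hψ : Differentiable ℝ ψ) (j : Fin 2) (x : Plane) :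
    partialDeriv j (φ * ψ) x = φ x * partialDeriv j ψ x + partialDeriv j φ x * ψ x := by
  simp [partialDeriv, fderiv_mul (hφ x) (hψ x), mul_comm]

theorem integral_partialDeriv_mul {U V : Set Plane} {φ : Plane → ℝ} {ψ : Plane → ℂ}
    (hφ : IsTestFunction U φ) (hψ : IsTestFunction V ψ) (j : Fin 2) :
    ∫ x, ((partialDeriv j φ x : ℝ) : ℂ) * ψ x = -∫ x, (φ x : ℂ) * partialDeriv j ψ x := by
  have hI : ∀ (a : Plane → ℝ) (b : Plane → ℂ), Continuous a → HasCompactSupport a → Continuous b →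
      Integrable (fun x => a x • b x) := fun a b ha ha' hb =>
    (ha.smul hb).integrable_of_hasCompactSupport ha'.smul_right
  have := integral_smul_fderiv_eq_neg_fderiv_smul_of_integrable (μ := (volume : Measure Plane))
    (f := φ) (g := ψ) (v := EuclideanSpace.single j 1)
    (hI _ _ (hφ.continuous_partialDeriv j) (hφ.hasCompactSupport_partialDeriv j) hψ.continuous)
    (hI _ _ hφ.continuous hφ.compact (hψ.continuous_partialDeriv j))
    (hI _ _ hφ.continuous hφ.compact hψ.continuous)
    (fun x _ => hφ.differentiable x) (fun x _ => hψ.differentiable x)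
  simp only [Complex.real_smul] at this
  simp only [partialDeriv]
  rw [this, neg_neg]

/-! ### `L²` convergence -/

theorem tendsto_integral_mul_of_tendsto_eLpNorm_two {α : Type*} [MeasurableSpace α] {μ : Measure α}
    {a f : α → ℂ} {F : ℕ → α → ℂ} (ha : MemLp a 2 μ) (hf : MemLp f 2 μ) (hF : ∀ n, MemLp (F n) 2 μ)
    (h : Tendsto (fun n => eLpNorm (f - F n) 2 μ) atTop (𝓝 0)) :
    Tendsto (fun n => ∫ x, a x * F n x ∂μ) atTop (𝓝 (∫ x, a x * f x ∂μ)) := by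
  refine tendsto_integral_of_L1' _ (ha.integrable_mul hf).1
    (Eventually.of_forall fun n => ha.integrable_mul (hF n)) ?_
  have h0 : Tendsto (fun n => eLpNorm a 2 μ * eLpNorm (f - F n) 2 μ) atTop (𝓝 0) := by
    simpa using ENNReal.Tendsto.const_mul h (Or.inr ha.2.ne)
  refine tendsto_of_tendsto_of_tendsto_of_le_of_le tendsto_const_nhds h0 (fun _ => zero_le) ?_
  intro n
  have := eLpNorm_smul_le_mul_eLpNorm (p := 2) (q := 2) (r := 1) (hf.sub (hF n)).1 ha.1
  refine le_trans (le_of_eq ?_) this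
  simp only
  rw [← eLpNorm_neg]
  congr 1
  ext x
  simp
  ring

/-! ### Constructing elements of `H¹₀` -/

/-- Integration by parts holds for each smooth approximant and both sides pass to the L² limit. The
approximants vanish outside U, so the support of ψ is free to leave U. -/
theorem integral_weak_of_approx {U : Set Plane} {u g : Plane → ℂ} {j : Fin 2}
    (hu : MemLp u 2 (volume.restrict U)) (hg : MemLp g 2 (volume.restrict U)) {φ : ℕ → Plane → ℂ}
    (hφ : ∀ n, IsTestFunction U (φ n))
    (h0 : Tendsto (fun n => eLpNorm (u - φ n) 2 (volume.restrict U)) atTop (𝓝 0))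
    (h1 : Tendsto (fun n => eLpNorm (g - partialDeriv j (φ n)) 2 (volume.restrict U)) atTop (𝓝 0))
    {V : Set Plane} {ψ : Plane → ℝ} (hψ : IsTestFunction V ψ) :
    ∫ x in U, ((partialDeriv j ψ x : ℝ) : ℂ) * u x = -∫ x in U, (ψ x : ℂ) * g x := by
  have hA := tendsto_integral_mul_of_tendsto_eLpNorm_two
    (hψ.memLp_partialDeriv j 2 (volume.restrict U)).ofReal hu
    (fun n => (hφ n).memLp 2 _) h0
  have hB := tendsto_integral_mul_of_tendsto_eLpNorm_two
    (hψ.memLp 2 (volume.restrict U)).ofReal hg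
    (fun n => (hφ n).memLp_partialDeriv j 2 _) h1
  refine tendsto_nhds_unique hA (hB.neg.congr fun n => ?_)
  rw [setIntegral_eq_integral_of_forall_compl_eq_zero
      (fun x hx => by rw [(hφ n).partialDeriv_eq_zero j hx, mul_zero]),
    setIntegral_eq_integral_of_forall_compl_eq_zero
      (fun x hx => by rw [(hφ n).eq_zero hx, mul_zero])]
  exact (integral_partialDeriv_mul hψ (hφ n) j).symm

/-- The weak-gradient identity follows from the approximation, so each closure property of H¹₀ below
only has to be checked on approximating sequences. -/
theorem MemH10.of_approx {U : Set Plane} {u : Plane → ℂ} {g : Fin 2 → Plane → ℂ}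
    (hu : MemLp u 2 (volume.restrict U)) (hg : ∀ j, MemLp (g j) 2 (volume.restrict U))
    {φ : ℕ → Plane → ℂ} (hφ : ∀ n, IsTestFunction U (φ n))
    (h0 : Tendsto (fun n => eLpNorm (u - φ n) 2 (volume.restrict U)) atTop (𝓝 0))
    (h1 : ∀ j, Tendsto (fun n => eLpNorm (g j - partialDeriv j (φ n)) 2 (volume.restrict U))
      atTop (𝓝 0)) : MemH10 U u g where
  memLp := hu
  memLp_grad := hg
  weak_grad _ hψ j := integral_weak_of_approx hu (hg j) hφ h0 (h1 j) hψ
  approx := ⟨φ, hφ, h0, h1⟩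

theorem IsTestFunction.memH10 {U : Set Plane} {φ : Plane → ℂ} (h : IsTestFunction U φ) :
    MemH10 U φ (fun j => partialDeriv j φ) :=
  .of_approx (h.memLp 2 _) (fun j => h.memLp_partialDeriv j 2 _) (φ := fun _ => φ)
    (fun _ => h) (by simp) (by simp)

theorem MemH10.add {U : Set Plane} {u v : Plane → ℂ} {g h : Fin 2 → Plane → ℂ}
    (hu : MemH10 U u g) (hv : MemH10 U v h) : MemH10 U (u + v) (fun j => g j + h j) := by
  obtain ⟨φ, hφ, hφ0, hφ1⟩ := hu.approx
  obtain ⟨ψ, hψ, hψ0, hψ1⟩ := hv.approx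
  have key : ∀ {f k : Plane → ℂ} {F K : ℕ → Plane → ℂ},
      MemLp f 2 (volume.restrict U) → MemLp k 2 (volume.restrict U) →
      (∀ n, MemLp (F n) 2 (volume.restrict U)) → (∀ n, MemLp (K n) 2 (volume.restrict U)) →
      Tendsto (fun n => eLpNorm (f - F n) 2 (volume.restrict U)) atTop (𝓝 0) →
      Tendsto (fun n => eLpNorm (k - K n) 2 (volume.restrict U)) atTop (𝓝 0) →
      Tendsto (fun n => eLpNorm (f + k - (F n + K n)) 2 (volume.restrict U)) atTop (𝓝 0) := by
    intro f k F K hf hk hF hK h1 h2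
    refine tendsto_of_tendsto_of_tendsto_of_le_of_le tendsto_const_nhds
      (by simpa using h1.add h2) (fun _ => zero_le) fun n => ?_
    simp only
    rw [add_sub_add_comm]
    exact eLpNorm_add_le (hf.sub (hF n)).1 (hk.sub (hK n)).1 (by norm_num)
  refine .of_approx (hu.memLp.add hv.memLp) (fun j => (hu.memLp_grad j).add (hv.memLp_grad j))
    (fun n => (hφ n).add (hψ n))
    (key hu.memLp hv.memLp (fun n => (hφ n).memLp 2 _) (fun n => (hψ n).memLp 2 _) hφ0 hψ0)
    fun j => ?_
  simp only [partialDeriv_add (hφ _).differentiable (hψ _).differentiable]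
  exact key (hu.memLp_grad j) (hv.memLp_grad j) (fun n => (hφ n).memLp_partialDeriv j 2 _)
    (fun n => (hψ n).memLp_partialDeriv j 2 _) (hφ1 j) (hψ1 j)

/-- Extension by zero: the approximants already vanish outside U, so the same sequence works in V,
whatever the boundary of U. -/
theorem MemH10.indicator {U V : Set Plane} (hU : MeasurableSet U) (hUV : U ⊆ V) {u : Plane → ℂ}
    {g : Fin 2 → Plane → ℂ} (hu : MemH10 U u g) :
    MemH10 V (U.indicator u) (fun j => U.indicator (g j)) := by
  obtain ⟨φ, hφ, hφ0, hφ1⟩ := hu.approx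
  have hr : (volume.restrict V).restrict U = volume.restrict U := by
    rw [Measure.restrict_restrict hU, Set.inter_eq_left.2 hUV]
  have hm : ∀ {f : Plane → ℂ}, MemLp f 2 (volume.restrict U) →
      MemLp (U.indicator f) 2 (volume.restrict V) := by
    intro f hf
    rwa [memLp_indicator_iff_restrict hU, hr]
  have hk : ∀ (f k : Plane → ℂ), (∀ x ∉ U, k x = 0) →
      eLpNorm (U.indicator f - k) 2 (volume.restrict V) =
        eLpNorm (f - k) 2 (volume.restrict U) := by
    intro f k h
    rw [← hr, ← eLpNorm_indicator_eq_eLpNorm_restrict hU]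
    congr 1
    ext x
    by_cases hx : x ∈ U <;> simp [hx, h]
  refine .of_approx (hm hu.memLp) (fun j => hm (hu.memLp_grad j)) (fun n => (hφ n).mono hUV)
    ?_ fun j => ?_
  · simpa only [hk _ _ (fun x hx => (hφ _).eq_zero hx)] using hφ0
  · simpa only [hk _ _ (fun x hx => (hφ _).partialDeriv_eq_zero j hx)] using hφ1 j

/-- Multiplication by a bounded smooth function with bounded gradient preserves `H¹₀`. -/
theorem MemH10.smooth_mul {U : Set Plane} {u : Plane → ℂ} {g : Fin 2 → Plane → ℂ}
    (hu : MemH10 U u g) {a : Plane → ℂ} (ha : ContDiff ℝ ∞ a) {B : ℝ} (hB : ∀ x, ‖a x‖ ≤ B)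
    (hB' : ∀ j x, ‖partialDeriv j a x‖ ≤ B) :
    MemH10 U (a * u) (fun j => a * g j + partialDeriv j a * u) := by
  obtain ⟨φ, hφ, hφ0, hφ1⟩ := hu.approx
  have hac := ha.continuous
  have hadc : ∀ j, Continuous (partialDeriv j a) := fun j =>
    (ha.continuous_fderiv (by simp)).clm_apply continuous_const
  have hm : ∀ {b f : Plane → ℂ}, Continuous b → (∀ x, ‖b x‖ ≤ B) →
      MemLp f 2 (volume.restrict U) → MemLp (b * f) 2 (volume.restrict U) := by
    intro b f hb hbB hf
    refine hf.of_le_mul (c := B) (hb.aestronglyMeasurable.mul hf.1) (Eventually.of_forall fun x => ?_)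
    simpa using mul_le_mul_of_nonneg_right (hbB x) (norm_nonneg _)
  have hk : ∀ {b f : Plane → ℂ} {F : ℕ → Plane → ℂ}, (∀ x, ‖b x‖ ≤ B) →
      Tendsto (fun n => eLpNorm (f - F n) 2 (volume.restrict U)) atTop (𝓝 0) →
      Tendsto (fun n => eLpNorm (b * f - b * F n) 2 (volume.restrict U)) atTop (𝓝 0) := by
    intro b f F hb h
    refine tendsto_of_tendsto_of_tendsto_of_le_of_le tendsto_const_nhds
      (by simpa using ENNReal.Tendsto.const_mul h (Or.inr ENNReal.ofReal_ne_top))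
      (fun _ => zero_le) fun n => eLpNorm_le_mul_eLpNorm_of_ae_le_mul (c := B)
        (Eventually.of_forall fun x => ?_) 2
    simp only [Pi.sub_apply, Pi.mul_apply, ← mul_sub, norm_mul]
    exact mul_le_mul_of_nonneg_right (hb x) (norm_nonneg _)
  have hm' := fun j => hm (hadc j) (hB' j) hu.memLp
  refine .of_approx (φ := fun n => a * φ n) (hm hac hB hu.memLp)
    (fun j => (hm hac hB (hu.memLp_grad j)).add (hm' j))
    (fun n => ⟨ha.mul (hφ n).smooth, (hφ n).compact.mul_left,
      (tsupport_mul_subset_right).trans (hφ n).support_subset⟩) (hk hB hφ0) fun j => ?_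
  refine tendsto_of_tendsto_of_tendsto_of_le_of_le tendsto_const_nhds
      (by simpa using (hk hB (hφ1 j)).add (hk (hB' j) hφ0)) (fun _ => zero_le) fun n => ?_
  have : a * g j + partialDeriv j a * u - partialDeriv j (a * φ n) =
      (a * g j - a * partialDeriv j (φ n)) + (partialDeriv j a * u - partialDeriv j a * φ n) := by
    ext x
    simp only [Pi.sub_apply, Pi.add_apply, Pi.mul_apply,
      partialDeriv_mul (ha.differentiable (by simp)) (hφ n).differentiable]
    ring
  simp only
  rw [this]
  exact eLpNorm_add_le
    ((hm hac hB (hu.memLp_grad j)).sub (hm hac hB ((hφ n).memLp_partialDeriv j 2 _))).1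
    ((hm' j).sub (hm (hadc j) (hB' j) ((hφ n).memLp 2 _))).1 (by norm_num)

theorem MemH10.const_mul {U : Set Plane} {u : Plane → ℂ} {g : Fin 2 → Plane → ℂ}
    (hu : MemH10 U u g) (c : ℂ) : MemH10 U (fun x => c * u x) (fun j x => c * g j x) := by
  have h0 : ∀ j, partialDeriv j (fun _ : Plane => c) = 0 := fun j => by
    ext x; simp [partialDeriv]
  have := hu.smooth_mul (a := fun _ => c) contDiff_const (B := ‖c‖) (fun _ => le_rfl)
    (by simp [h0])
  simpa [h0, Pi.mul_def] using this

theorem MemH10.comp_sub {U : Set Plane} {u : Plane → ℂ} {g : Fin 2 → Plane → ℂ}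
    (hU : MeasurableSet U) (hu : MemH10 U u g) (a : Plane) :
    MemH10 ((fun x => x - a) ⁻¹' U) (fun x => u (x - a)) (fun j x => g j (x - a)) := by
  obtain ⟨φ, hφ, hφ0, hφ1⟩ := hu.approx
  have hmp := (measurePreserving_sub_right (volume : Measure Plane) a).restrict_preimage hU
  have hm : ∀ {f : Plane → ℂ}, MemLp f 2 (volume.restrict U) →
      MemLp (fun x => f (x - a)) 2 (volume.restrict ((fun x => x - a) ⁻¹' U)) := fun hf =>
    hf.comp_measurePreserving hmp
  have hd : ∀ n j, partialDeriv j (fun x => φ n (x - a)) = fun x => partialDeriv j (φ n) (x - a) := by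
    intro n j
    ext x
    simp [partialDeriv, fderiv_comp_sub]
  have he : ∀ {f k : Plane → ℂ}, MemLp f 2 (volume.restrict U) → MemLp k 2 (volume.restrict U) →
      eLpNorm ((fun x => f (x - a)) - fun x => k (x - a)) 2
        (volume.restrict ((fun x => x - a) ⁻¹' U)) = eLpNorm (f - k) 2 (volume.restrict U) :=
    fun hf hk => eLpNorm_comp_measurePreserving (g := _ - _) (hf.sub hk).1 hmp
  refine .of_approx (φ := fun n x => φ n (x - a)) (hm hu.memLp) (fun j => hm (hu.memLp_grad j))
    (fun n => ⟨(hφ n).smooth.comp (contDiff_id.sub contDiff_const),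
      (hφ n).compact.comp_homeomorph (Homeomorph.subRight a), ?_⟩) ?_ fun j => ?_
  · have := tsupport_comp_eq_preimage (φ n) (Homeomorph.subRight a)
    exact this.subset.trans (Set.preimage_mono (hφ n).support_subset)
  · simpa only [he hu.memLp ((hφ _).memLp 2 _)] using hφ0
  · simpa only [hd, he (hu.memLp_grad j) ((hφ _).memLp_partialDeriv j 2 _)] using hφ1 j

/-! ### Mollification -/

/-- Continuity of translations in L², read off from the continuity of composition with a
continuously varying family of measure-preserving maps. -/
theorem tendsto_eLpNorm_translate_sub {f : Plane → ℂ} (hf : MemLp f 2 volume) :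
    Tendsto (fun t => eLpNorm (fun x => f x - f (x - t)) 2 volume) (𝓝 (0 : Plane)) (𝓝 0) := by
  have hmp : ∀ t : Plane, MeasurePreserving (fun x => x - t) volume volume := fun t =>
    measurePreserving_sub_right volume t
  let σ : C(Plane, C(Plane, Plane)) :=
    (ContinuousMap.mk (fun a : Plane × Plane => a.2 - a.1) (by fun_prop)).curry
  have h := (tendsto_const_nhds (x := hf.toLp f) (f := 𝓝 (0 : Plane))).compMeasurePreservingLp
    (σ.continuous.tendsto 0) (fun t => hmp t) (hmp 0) ENNReal.ofNat_ne_top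
  rw [tendsto_iff_edist_tendsto_0] at h
  refine h.congr fun t => ?_
  rw [edist_comm, Lp.edist_def]
  refine eLpNorm_congr_ae ?_
  have h1 : ∀ t, Lp.compMeasurePreserving (σ t) (hmp t) (hf.toLp f) =ᵐ[volume]
      fun x => f (x - t) := fun t =>
    (Lp.coeFn_compMeasurePreserving _ _).trans
      ((hmp t).quasiMeasurePreserving.ae_eq_comp hf.coeFn_toLp)
  filter_upwards [h1 t, h1 0] with x hx hx0
  simp [hx, hx0]

/-- K dt is a probability measure, so the left side is the squared norm of a mean and Jensen's
inequality applies, in the form L¹ norm ≤ L² norm. -/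
theorem enorm_sub_integral_smul_sq_le {f : Plane → ℂ} {x : Plane} {K : Plane → ℝ}
    (hf : LocallyIntegrable f volume) (hK : Continuous K) (hKc : HasCompactSupport K)
    (hK0 : ∀ x, 0 ≤ K x) (hK1 : ∫ x, K x = 1) :
    ‖f x - ∫ t, K (x - t) • f t‖ₑ ^ 2 ≤
      ∫⁻ t, ‖f x - f (x - t)‖ₑ ^ 2 ∂(volume.withDensity fun t => ENNReal.ofReal (K t)) := by
  set ν := (volume : Measure Plane).withDensity fun t => ENNReal.ofReal (K t) with hν
  have hKi : Integrable K := hK.integrable_of_hasCompactSupport hKc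
  have hprob : IsProbabilityMeasure ν := by
    constructor
    rw [hν, withDensity_apply _ MeasurableSet.univ, Measure.restrict_univ,
      ← ofReal_integral_eq_lintegral_ofReal hKi (Eventually.of_forall hK0), hK1, ENNReal.ofReal_one]
  have hint : Integrable (fun t => K t • f (x - t)) :=
    hKc.convolutionExists_left (ContinuousLinearMap.lsmul ℝ ℝ) hK hf x
  have hswap : ∫ t, K (x - t) • f t = ∫ t, K t • f (x - t) := by
    rw [← integral_sub_left_eq_self (fun t => K t • f (x - t)) volume x]
    simp
  have hd : ∀ h : Plane → ℂ, ∫ t, h t ∂ν = ∫ t, K t • h t := by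
    intro h
    rw [hν, integral_withDensity_eq_integral_toReal_smul
      (hK.measurable.ennreal_ofReal) (by simp)]
    simp [ENNReal.toReal_ofReal (hK0 _)]
  have heq : f x - ∫ t, K (x - t) • f t = ∫ t, (f x - f (x - t)) ∂ν := by
    rw [hd, hswap]
    simp only [smul_sub]
    rw [integral_sub (hKi.smul_const _) hint, integral_smul_const, hK1, one_smul]
  have hm : AEStronglyMeasurable (fun t => f x - f (x - t)) ν := by
    refine AEStronglyMeasurable.mono_ac (withDensity_absolutelyContinuous _ _) ?_
    exact aestronglyMeasurable_const.sub (hf.aestronglyMeasurable.comp_quasiMeasurePreserving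
      (quasiMeasurePreserving_sub_left volume x))
  have h12 := eLpNorm_le_eLpNorm_of_exponent_le (p := 1) (q := 2) (by norm_num) hm
  rw [heq]
  have h1 : ‖∫ t, (f x - f (x - t)) ∂ν‖ₑ ≤ eLpNorm (fun t => f x - f (x - t)) 2 ν :=
    (enorm_integral_le_lintegral_enorm _).trans (by rwa [eLpNorm_one_eq_lintegral_enorm] at h12)
  calc _ ≤ eLpNorm (fun t => f x - f (x - t)) 2 ν ^ 2 := by gcongr
    _ = _ := by
      have := eLpNorm_nnreal_pow_eq_lintegral (f := fun t => f x - f (x - t)) (p := 2) (μ := ν)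
        (by norm_num)
      simpa using this

/-- Integrating the pointwise Jensen bound and exchanging integrals bounds the mollification error
by the worst translation error over the support of K. -/
theorem eLpNorm_sub_integral_smul_le {f : Plane → ℂ} (hf : MemLp f 2 volume) {K : Plane → ℝ}
    (hK : Continuous K) (hKc : HasCompactSupport K)
    (hK0 : ∀ x, 0 ≤ K x) (hK1 : ∫ x, K x = 1) {ε : ℝ≥0∞}
    (hε : ∀ t, K t ≠ 0 → eLpNorm (fun x => f x - f (x - t)) 2 volume ≤ ε) :
    eLpNorm (fun x => f x - ∫ t, K (x - t) • f t) 2 volume ≤ ε := by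
  set ν := (volume : Measure Plane).withDensity fun t => ENNReal.ofReal (K t) with hν
  have hKi : Integrable K := hK.integrable_of_hasCompactSupport hKc
  have hprob : IsProbabilityMeasure ν := by
    constructor
    rw [hν, withDensity_apply _ MeasurableSet.univ, Measure.restrict_univ,
      ← ofReal_integral_eq_lintegral_ofReal hKi (Eventually.of_forall hK0), hK1, ENNReal.ofReal_one]
  have hsq : ∀ h : Plane → ℂ, eLpNorm h 2 volume ^ 2 = ∫⁻ x, ‖h x‖ₑ ^ 2 := by
    intro h
    simpa using eLpNorm_nnreal_pow_eq_lintegral (f := h) (p := 2)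
      (μ := (volume : Measure Plane)) (by norm_num)
  rw [← ENNReal.pow_le_pow_left_iff (two_ne_zero), hsq]
  have hfl : LocallyIntegrable f volume := hf.locallyIntegrable (by norm_num)
  have hm : AEMeasurable (Function.uncurry fun x t => ‖f x - f (x - t)‖ₑ ^ 2)
      ((volume : Measure Plane).prod ν) := by
    refine AEMeasurable.pow_const (AEStronglyMeasurable.enorm ?_) 2
    exact (hf.1.comp_fst).sub (hf.1.comp_quasiMeasurePreserving
      (quasiMeasurePreserving_sub_of_right_invariant volume ν))
  calc ∫⁻ x, ‖f x - ∫ t, K (x - t) • f t‖ₑ ^ 2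
      ≤ ∫⁻ x, ∫⁻ t, ‖f x - f (x - t)‖ₑ ^ 2 ∂ν :=
        lintegral_mono fun x => enorm_sub_integral_smul_sq_le hfl hK hKc hK0 hK1
    _ = ∫⁻ t, (∫⁻ x, ‖f x - f (x - t)‖ₑ ^ 2) ∂ν := lintegral_lintegral_swap hm
    _ ≤ ∫⁻ t, ε ^ 2 ∂ν := by
        refine lintegral_mono_ae ?_
        rw [hν, ae_withDensity_iff hK.measurable.ennreal_ofReal]
        refine Eventually.of_forall fun t ht => ?_
        rw [← hsq]
        gcongr
        exact hε t fun h => ht (by simp [h])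
    _ = ε ^ 2 := by simp

/-- A compactly supported element of `H¹(ℝ²)` with support inside the open set `U` is a limit in
`H¹` of test functions on `U`. -/
theorem exists_testFunction_approx {U S : Set Plane} (hU : IsOpen U) (hS : IsCompact S)
    (hSU : S ⊆ U) {v : Plane → ℂ} {h : Fin 2 → Plane → ℂ} (hv : MemLp v 2 volume)
    (hh : ∀ j, MemLp (h j) 2 volume) (hvS : ∀ x ∉ S, v x = 0)
    (hw : ∀ ψ : Plane → ℝ, IsTestFunction Set.univ ψ → ∀ j,
      ∫ x, ((partialDeriv j ψ x : ℝ) : ℂ) * v x = -∫ x, (ψ x : ℂ) * h j x)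
    {ε : ℝ≥0∞} (hε : 0 < ε) :
    ∃ φ : Plane → ℂ, IsTestFunction U φ ∧ eLpNorm (v - φ) 2 volume ≤ ε ∧
      ∀ j, eLpNorm (h j - partialDeriv j φ) 2 volume ≤ ε := by
  obtain ⟨δ, hδ, hδU⟩ := hS.exists_cthickening_subset_open hU hSU
  have hev : ∀ᶠ t in 𝓝 (0 : Plane), (eLpNorm (fun x => v x - v (x - t)) 2 volume ≤ ε ∧
      ∀ j, eLpNorm (fun x => h j x - h j (x - t)) 2 volume ≤ ε) ∧ dist t 0 < δ :=
    (((tendsto_eLpNorm_translate_sub hv).eventually_le_const hε).and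
      (eventually_all.2 fun j => (tendsto_eLpNorm_translate_sub (hh j)).eventually_le_const hε)).and
      (Metric.ball_mem_nhds 0 hδ)
  obtain ⟨r, hr, hball⟩ := Metric.eventually_nhds_iff_ball.1 hev
  let b : ContDiffBump (0 : Plane) := ⟨r / 2, r, by positivity, by linarith⟩
  set K : Plane → ℝ := b.normed volume with hKdef
  have hK : ContDiff ℝ ∞ K := b.contDiff_normed
  have hKc : HasCompactSupport K := b.hasCompactSupport_normed
  have hK0 : ∀ x, 0 ≤ K x := b.nonneg_normed
  have hK1 : ∫ x, K x = 1 := b.integral_normed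
  have hKs : ∀ t, K t ≠ 0 → t ∈ Metric.ball (0 : Plane) r := by
    intro t ht
    have : t ∈ Function.support K := ht
    rwa [hKdef, b.support_normed_eq] at this
  have hvl : LocallyIntegrable v volume := hv.locallyIntegrable (by norm_num)
  set L : ℂ →L[ℝ] ℝ →L[ℝ] ℂ := (ContinuousLinearMap.lsmul ℝ ℝ).flip
  have hvc : HasCompactSupport v := HasCompactSupport.intro hS hvS
  have hsupp : tsupport (v ⋆[L, volume] K) ⊆ U := by
    refine (closure_minimal ?_ Metric.isClosed_cthickening).trans hδU
    refine (support_convolution_subset L).trans ?_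
    rintro _ ⟨s, hs, t, ht, rfl⟩
    have hsS : s ∈ S := by
      by_contra hn
      exact hs (hvS s hn)
    refine Metric.mem_cthickening_of_dist_le _ s δ S hsS ?_
    have := (hball t (hKs t ht)).2.le
    simpa using this
  have hder : ∀ j x, partialDeriv j (v ⋆[L, volume] K) x = ∫ t, K (x - t) • h j t := by
    intro j x
    have h1 := (hKc.hasFDerivAt_convolution_right L hvl (hK.of_le (by simp)) x).fderiv
    rw [partialDeriv, h1, convolution_precompR_apply L hvl (hKc.fderiv ℝ)
      (hK.continuous_fderiv (by simp))]
    -- Testing the weak gradient of v against t ↦ K (x - t) moves the derivative from the kernel to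
    -- h. The two minus signs cancel.
    have h2 := hw (fun t => K (x - t)) ⟨hK.comp (contDiff_const.sub contDiff_id),
      hKc.comp_homeomorph (Homeomorph.subLeft x), Set.subset_univ _⟩ j
    have h3 : ∀ t, partialDeriv j (fun t => K (x - t)) t = -partialDeriv j K (x - t) := by
      intro t
      have := (((hK.differentiable (by simp)) (x - t)).hasFDerivAt.comp t
        ((hasFDerivAt_id t).const_sub x)).fderiv
      simp only [partialDeriv]
      have h4 : fderiv ℝ (fun t => K (x - t)) t =
          (fderiv ℝ K (x - t)).comp (-ContinuousLinearMap.id ℝ Plane) := this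
      rw [h4]
      simp
    simp only [h3, Complex.ofReal_neg, neg_mul, integral_neg, neg_inj] at h2
    simp only [Complex.real_smul, ← h2]
    rfl
  refine ⟨v ⋆[L, volume] K, ⟨hKc.contDiff_convolution_right L hvl hK, hvc.convolution L hKc,
    hsupp⟩, ?_, fun j => ?_⟩
  · exact eLpNorm_sub_integral_smul_le hv hK.continuous hKc hK0 hK1
      fun t ht => (hball t (hKs t ht)).1.1
  · have := eLpNorm_sub_integral_smul_le (hh j) hK.continuous hKc hK0 hK1
      fun t ht => (hball t (hKs t ht)).1.2 j
    simp only [← hder] at this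
    exact this

/-- Cutting off an `H¹` function by a test function gives an element of `H¹₀`. -/
theorem MemH1.cutoff {U : Set Plane} (hU : IsOpen U) {u : Plane → ℂ} {g : Fin 2 → Plane → ℂ}
    (hu : MemH1 U u g) {χ : Plane → ℝ} (hχ : IsTestFunction U χ) :
    MemH10 U (fun x => (χ x : ℂ) * u x)
      (fun j x => (χ x : ℂ) * g j x + ((partialDeriv j χ x : ℝ) : ℂ) * u x) := by
  have hmul : ∀ {a : Plane → ℝ} {f : Plane → ℂ}, Continuous a → HasCompactSupport a →
      MemLp f 2 (volume.restrict U) → MemLp (fun x => (a x : ℂ) * f x) 2 (volume.restrict U) := by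
    intro a f ha hac hf
    obtain ⟨C, hC⟩ := ha.bounded_above_of_compact_support hac
    refine hf.of_le_mul (c := C) (((Complex.continuous_ofReal.comp ha).aestronglyMeasurable).mul
      hf.1) (Eventually.of_forall fun x => ?_)
    rw [norm_mul, Complex.norm_real]
    exact mul_le_mul_of_nonneg_right (hC x) (norm_nonneg _)
  have hext : ∀ {f : Plane → ℂ}, (∀ x ∉ U, f x = 0) → MemLp f 2 (volume.restrict U) →
      MemLp f 2 volume := by
    intro f hf hm
    rwa [← Set.indicator_eq_self.2 (Function.support_subset_iff'.2 hf),
      memLp_indicator_iff_restrict hU.measurableSet]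
  have hdc := hχ.continuous_partialDeriv
  have hdcs := hχ.hasCompactSupport_partialDeriv
  have hv := hmul hχ.continuous hχ.compact hu.memLp
  have hh := fun j => (hmul hχ.continuous hχ.compact (hu.memLp_grad j)).add
    (hmul (hdc j) (hdcs j) hu.memLp)
  have hvz : ∀ x ∉ U, (χ x : ℂ) * u x = 0 := fun x hx => by simp [hχ.eq_zero hx]
  have hhz : ∀ j, ∀ x ∉ U, (χ x : ℂ) * g j x + ((partialDeriv j χ x : ℝ) : ℂ) * u x = 0 :=
    fun j x hx => by simp [hχ.eq_zero hx, hχ.partialDeriv_eq_zero j hx]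
  have hint : ∀ {a b : Plane → ℝ} {f : Plane → ℂ}, Continuous a → HasCompactSupport a →
      Continuous b → HasCompactSupport b → MemLp f 2 (volume.restrict U) →
      Integrable (fun x => (a x : ℂ) * ((b x : ℂ) * f x)) (volume.restrict U) := by
    intro a b f ha hac hb hbc hf
    have ha2 : MemLp a 2 (volume.restrict U) := ha.memLp_of_hasCompactSupport hac
    exact ha2.ofReal.integrable_mul (hmul hb hbc hf)
  have hweak : ∀ ψ : Plane → ℝ, IsTestFunction Set.univ ψ → ∀ j,
      ∫ x, ((partialDeriv j ψ x : ℝ) : ℂ) * ((χ x : ℂ) * u x) =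
        -∫ x, (ψ x : ℂ) * ((χ x : ℂ) * g j x + ((partialDeriv j χ x : ℝ) : ℂ) * u x) := by
    intro ψ hψ j
    -- ψχ is supported in U even though ψ need not be. Its product rule yields exactly the extra
    -- term u ∂χ in the gradient of χu.
    have h1 := hu.weak_grad (ψ * χ) ⟨hψ.smooth.mul hχ.smooth, hψ.compact.mul_right,
      tsupport_mul_subset_right.trans hχ.support_subset⟩ j
    have e1 : ∫ x in U, ((partialDeriv j ψ x : ℝ) : ℂ) * ((χ x : ℂ) * u x) =
        ∫ x, ((partialDeriv j ψ x : ℝ) : ℂ) * ((χ x : ℂ) * u x) :=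
      setIntegral_eq_integral_of_forall_compl_eq_zero fun x hx => by rw [hvz x hx, mul_zero]
    have e2 : ∫ x in U, (ψ x : ℂ) * ((χ x : ℂ) * g j x + ((partialDeriv j χ x : ℝ) : ℂ) * u x) =
        ∫ x, (ψ x : ℂ) * ((χ x : ℂ) * g j x + ((partialDeriv j χ x : ℝ) : ℂ) * u x) :=
      setIntegral_eq_integral_of_forall_compl_eq_zero fun x hx => by rw [hhz j x hx, mul_zero]
    rw [← e1, ← e2]
    simp only [partialDeriv_mul hψ.differentiable hχ.differentiable, Pi.mul_apply,
      Complex.ofReal_add, Complex.ofReal_mul, add_mul, mul_assoc] at h1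
    rw [integral_add (hint hψ.continuous hψ.compact (hdc j) (hdcs j) hu.memLp)
      (hint (hψ.continuous_partialDeriv j) (hψ.hasCompactSupport_partialDeriv j) hχ.continuous
        hχ.compact hu.memLp)] at h1
    simp only [mul_add]
    rw [integral_add (hint hψ.continuous hψ.compact hχ.continuous hχ.compact (hu.memLp_grad j))
      (hint hψ.continuous hψ.compact (hdc j) (hdcs j) hu.memLp)]
    linear_combination h1
  have hex := fun n : ℕ => exists_testFunction_approx hU hχ.compact hχ.support_subset
    (hext hvz hv) (fun j => hext (hhz j) (hh j))
    (fun x hx => by simp [image_eq_zero_of_notMem_tsupport hx]) hweak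
    (ε := ((n : ℝ≥0∞) + 1)⁻¹) (by simp)
  choose φ hφ hφ0 hφ1 using hex
  have hlim : Tendsto (fun n : ℕ => ((n : ℝ≥0∞) + 1)⁻¹) atTop (𝓝 0) := by
    simpa using (tendsto_add_atTop_iff_nat 1).2 ENNReal.tendsto_inv_nat_nhds_zero
  refine .of_approx hv hh hφ ?_ fun j => ?_
  · exact tendsto_of_tendsto_of_tendsto_of_le_of_le tendsto_const_nhds hlim (fun _ => zero_le)
      fun n => (eLpNorm_mono_measure _ Measure.restrict_le_self).trans (hφ0 n)
  · exact tendsto_of_tendsto_of_tendsto_of_le_of_le tendsto_const_nhds hlim (fun _ => zero_le)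
      fun n => (eLpNorm_mono_measure _ Measure.restrict_le_self).trans (hφ1 n j)

/-! ### Properties of the Dirichlet energy -/

theorem dirichletEnergy_le {G : ℝ} {U : Set Plane} {u : Plane → ℂ} {g : Fin 2 → Plane → ℂ}
    (hu : MemH10 U u g) {M : ℝ≥0∞} (hM : mass U u = M) :
    dirichletEnergy G U M ≤ gpFunctional G U u g :=
  sInf_le ⟨u, g, hu, hM, rfl⟩

theorem neumannEnergy_le_dirichletEnergy (G : ℝ) (U : Set Plane) (M : ℝ≥0∞) :
    neumannEnergy G U M ≤ dirichletEnergy G U M :=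
  sInf_le_sInf fun _ ⟨u, g, hu, hM, hE⟩ => ⟨u, g, hu.toMemH1, hM, hE⟩

/-- The integrand Φ is left general so that one statement gives additivity of both the mass and the
energy for functions glued from disjoint sets. -/
theorem setLIntegral_indicator_add_indicator {U V W : Set Plane} (hU : MeasurableSet U)
    (hV : MeasurableSet V) (hUV : Disjoint U V) (hUW : U ⊆ W) (hVW : V ⊆ W)
    (Φ : Plane → ℂ → (Fin 2 → ℂ) → ℝ≥0∞) (hΦ : ∀ x, Φ x 0 0 = 0) (u v : Plane → ℂ)
    (g h : Fin 2 → Plane → ℂ) :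
    ∫⁻ x in W, Φ x ((U.indicator u + V.indicator v) x)
        (fun j => (U.indicator (g j) + V.indicator (h j)) x) =
      (∫⁻ x in U, Φ x (u x) fun j => g j x) + ∫⁻ x in V, Φ x (v x) fun j => h j x := by
  have hsub : U ∪ V ⊆ W := Set.union_subset hUW hVW
  set F : Plane → ℝ≥0∞ := fun x => Φ x ((U.indicator u + V.indicator v) x)
    (fun j => (U.indicator (g j) + V.indicator (h j)) x) with hF
  have hind : F = (U ∪ V).indicator F := by
    refine (Set.indicator_eq_self.2 (Function.support_subset_iff'.2 fun x hx => ?_)).symm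
    rw [Set.mem_union, not_or] at hx
    simpa [hF, hx.1, hx.2, Pi.zero_def] using hΦ x
  rw [hind, setLIntegral_indicator (hU.union hV), Set.inter_eq_left.2 hsub,
    lintegral_union hV hUV]
  congr 1
  · refine setLIntegral_congr_fun hU fun x hx => ?_
    have hx' : x ∉ V := hUV.notMem_of_mem_left hx
    simp [hF, hx, hx']
  · refine setLIntegral_congr_fun hV fun x hx => ?_
    have hx' : x ∉ U := hUV.notMem_of_mem_right hx
    simp [hF, hx, hx']

theorem dirichletEnergy_empty (G : ℝ) : dirichletEnergy G ∅ 0 = 0 := by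
  have := dirichletEnergy_le (G := G) (M := 0) (IsTestFunction.zero (F := ℂ) (U := ∅)).memH10
    (by simp [mass])
  simpa [gpFunctional] using this

theorem dirichletEnergy_add_le (G : ℝ) {U V W : Set Plane} (hU : MeasurableSet U)
    (hV : MeasurableSet V) (hUV : Disjoint U V) (hUW : U ⊆ W) (hVW : V ⊆ W) (M N : ℝ≥0∞) :
    dirichletEnergy G W (M + N) ≤ dirichletEnergy G U M + dirichletEnergy G V N := by
  conv_rhs => rw [dirichletEnergy, ENNReal.sInf_add]
  refine le_iInf₂ ?_
  rintro _ ⟨u, g, hu, rfl, rfl⟩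
  rw [add_comm (gpFunctional _ _ _ _), dirichletEnergy.eq_def G V, ENNReal.sInf_add]
  refine le_iInf₂ ?_
  rintro _ ⟨v, h, hv, rfl, rfl⟩
  refine (dirichletEnergy_le ((hu.indicator hU hUW).add (hv.indicator hV hVW)) ?_).trans ?_
  · exact setLIntegral_indicator_add_indicator hU hV hUV hUW hVW
      (fun _ z _ => ENNReal.ofReal (‖z‖ ^ 2)) (by simp) u v g h
  · rw [add_comm (gpFunctional _ _ _ _)]
    exact (setLIntegral_indicator_add_indicator hU hV hUV hUW hVW
      (fun x z w => ENNReal.ofReal ((1 / 2) *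
        ((∑ j, ‖-Complex.I * w j - (perp x j : ℂ) * z‖ ^ 2) + G * ‖z‖ ^ 4)))
      (by simp) u v g h).le

theorem dirichletEnergy_biUnion_le (G : ℝ) {ι : Type*} (s : Finset ι) (U : ι → Set Plane)
    (M : ι → ℝ≥0∞) (hU : ∀ i, MeasurableSet (U i)) (hd : (s : Set ι).PairwiseDisjoint U) :
    dirichletEnergy G (⋃ i ∈ s, U i) (∑ i ∈ s, M i) ≤ ∑ i ∈ s, dirichletEnergy G (U i) (M i) := by
  classical
  induction s using Finset.induction_on with
  | empty => simp [dirichletEnergy_empty]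
  | insert a s ha ih =>
    rw [Finset.sum_insert ha, Finset.sum_insert ha]
    rw [Finset.coe_insert, Set.pairwiseDisjoint_insert_of_notMem (by simpa using ha)] at hd
    refine (dirichletEnergy_add_le G (hU a) (s.measurableSet_biUnion fun i _ => hU i)
      (Set.disjoint_iUnion₂_right.2 fun i hi => hd.2 i hi) ?_ ?_ _ _).trans
      (add_le_add_right (ih hd.1) _)
    · exact Set.subset_biUnion_of_mem (u := U) (Finset.mem_insert_self a s)
    · exact Set.biUnion_subset_biUnion_left fun i hi => Finset.mem_insert_of_mem hi

/-- With the trial function √c u the quadratic term gains a factor c and the quartic term c², and c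
≤ c². -/
theorem dirichletEnergy_mul_le (G : ℝ) (U : Set Plane) (M : ℝ≥0∞) {c : ℝ}
    (hc : 1 ≤ c) :
    dirichletEnergy G U (ENNReal.ofReal c * M) ≤
      ENNReal.ofReal (c ^ 2) * dirichletEnergy G U M := by
  have hc0 : ENNReal.ofReal (c ^ 2) ≠ 0 := by simp; positivity
  rw [← ENNReal.div_le_iff' hc0 ENNReal.ofReal_ne_top]
  refine le_sInf ?_
  rintro _ ⟨u, g, hu, rfl, rfl⟩
  rw [ENNReal.div_le_iff' hc0 ENNReal.ofReal_ne_top]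
  have hn : ∀ z : ℂ, ‖(√c : ℂ) * z‖ ^ 2 = c * ‖z‖ ^ 2 := by
    intro z
    rw [norm_mul, Complex.norm_real, Real.norm_eq_abs, mul_pow, sq_abs, Real.sq_sqrt (by linarith)]
  refine (dirichletEnergy_le (hu.const_mul (√c : ℂ)) ?_).trans ?_
  · rw [mass, mass, ← lintegral_const_mul' _ _ ENNReal.ofReal_ne_top]
    refine lintegral_congr fun x => ?_
    rw [hn, ENNReal.ofReal_mul (by linarith)]
  · rw [gpFunctional, gpFunctional, ← lintegral_const_mul' _ _ ENNReal.ofReal_ne_top]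
    refine lintegral_mono fun x => ?_
    simp only
    rw [← ENNReal.ofReal_mul (by positivity)]
    refine ENNReal.ofReal_le_ofReal ?_
    have h1 : ∀ j, ‖-Complex.I * ((√c : ℂ) * g j x) - (perp x j : ℂ) * ((√c : ℂ) * u x)‖ ^ 2 =
        c * ‖-Complex.I * g j x - (perp x j : ℂ) * u x‖ ^ 2 := by
      intro j
      rw [← hn]
      ring_nf
    have h2 : ‖(√c : ℂ) * u x‖ ^ 4 = c ^ 2 * ‖u x‖ ^ 4 := by
      calc _ = (‖(√c : ℂ) * u x‖ ^ 2) ^ 2 := by ring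
        _ = _ := by rw [hn]; ring
    simp only [h1, h2, ← Finset.mul_sum]
    have h3 : 0 ≤ ∑ j, ‖-Complex.I * g j x - (perp x j : ℂ) * u x‖ ^ 2 :=
      Finset.sum_nonneg fun _ _ => by positivity
    nlinarith [mul_nonneg (mul_nonneg (by linarith : 0 ≤ c) (by linarith : 0 ≤ c - 1)) h3]

/-- Magnetic translations do not increase the Dirichlet energy. -/
theorem dirichletEnergy_translate_le (G : ℝ) {U : Set Plane} (hU : MeasurableSet U) (a : Plane)
    (M : ℝ≥0∞) :
    dirichletEnergy G ((fun x => x - a) ⁻¹' U) M ≤ dirichletEnergy G U M := by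
  refine le_sInf ?_
  rintro _ ⟨u, g, hu, rfl, rfl⟩
  -- The phase exp(i a^⊥·x) has gradient i a^⊥ times itself, which makes up for x^⊥ - (x - a)^⊥ =
  -- a^⊥.
  set θ : Plane →L[ℝ] ℝ := innerSL ℝ (perp a) with hθ
  have hθj : ∀ j, θ (EuclideanSpace.single j 1) = perp a j := by
    intro j
    simp [hθ, EuclideanSpace.inner_single_right]
  set e : Plane → ℂ := fun x => Complex.exp (θ x * Complex.I) with he
  have hed : ∀ x, HasFDerivAt e (e x • (θ.smulRight Complex.I)) x := by
    intro x
    have h1 : HasFDerivAt (fun x => (θ x : ℂ) * Complex.I) (θ.smulRight Complex.I) x :=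
      (θ.smulRight Complex.I).hasFDerivAt
    exact h1.cexp
  have hes : ContDiff ℝ ∞ e := by
    have : ContDiff ℝ ∞ (fun x => (θ.smulRight Complex.I) x) :=
      (θ.smulRight Complex.I).contDiff
    exact this.cexp
  have hen : ∀ x, ‖e x‖ = 1 := fun x => Complex.norm_exp_ofReal_mul_I _
  have hpd : ∀ j x, partialDeriv j e x = e x * (perp a j * Complex.I) := by
    intro j x
    simp [partialDeriv, (hed x).fderiv, hθj, Complex.real_smul]
  have hmem := (hu.comp_sub hU a).smooth_mul hes (B := 1 + ∑ j, |perp a j|)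
    (fun x => by rw [hen]; exact le_add_of_nonneg_right (Finset.sum_nonneg fun _ _ => abs_nonneg _))
    (fun j x => by
      rw [hpd, norm_mul, hen, one_mul, norm_mul, Complex.norm_I, mul_one, Complex.norm_real,
        Real.norm_eq_abs]
      exact (Finset.single_le_sum (f := fun j => |perp a j|) (fun _ _ => abs_nonneg _)
        (Finset.mem_univ j)).trans (by linarith))
  have hmp : ∀ F : Plane → ℝ≥0∞, ∫⁻ x in (fun x => x - a) ⁻¹' U, F (x - a) = ∫⁻ x in U, F x :=
    fun F => (measurePreserving_sub_right (volume : Measure Plane) a).setLIntegral_comp_preimage_emb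
      (Homeomorph.subRight a).measurableEmbedding F U
  refine (dirichletEnergy_le hmem ?_).trans (le_of_eq ?_)
  · rw [mass, mass, ← hmp]
    simp [hen]
  · rw [gpFunctional, gpFunctional, ← hmp]
    refine lintegral_congr fun x => ?_
    have h1 : ∀ j, ‖-Complex.I * ((e * fun x => g j (x - a)) + partialDeriv j e *
        fun x => u (x - a)) x - (perp x j : ℂ) * (e * fun x => u (x - a)) x‖ =
        ‖-Complex.I * g j (x - a) - (perp (x - a) j : ℂ) * u (x - a)‖ := by
      intro j
      rw [← one_mul ‖-Complex.I * g j (x - a) - _‖, ← hen x, ← norm_mul]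
      have h2 : (perp (x - a) j : ℂ) = perp x j - perp a j := by
        fin_cases j <;> simp [perp]; ring
      simp only [Pi.add_apply, Pi.mul_apply, hpd, h2]
      congr 1
      linear_combination (-e x * perp a j * u (x - a)) * Complex.I_sq
    have h2 : ‖(e * fun x => u (x - a)) x‖ = ‖u (x - a)‖ := by simp [hen]
    simp only [h1, h2]

/-! ### Localising H¹ functions: energy cost and mass loss -/

/-- The magnetic gradient of χu is χ times that of u, plus -i u∇χ. Young's inequality with parameter
δ separates the two, and 0 ≤ χ ≤ 1 handles the quartic term. -/
theorem dirichletEnergy_cutoff_le {G : ℝ} (hG : 0 ≤ G) {U : Set Plane} (hU : IsOpen U)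
    {u : Plane → ℂ} {g : Fin 2 → Plane → ℂ} (hu : MemH1 U u g) {χ : Plane → ℝ}
    (hχ : IsTestFunction U χ) (hχ01 : ∀ x, χ x ∈ Set.Icc (0 : ℝ) 1) {B : ℝ}
    (hB : ∀ x, ∑ j, partialDeriv j χ x ^ 2 ≤ B) {δ : ℝ} (hδ : 0 < δ) :
    dirichletEnergy G U (mass U fun x => (χ x : ℂ) * u x) ≤
      ENNReal.ofReal (1 + δ) * gpFunctional G U u g +
        ENNReal.ofReal ((1 + δ⁻¹) * B / 2) * mass U u := by
  have hB0 : 0 ≤ B := (Finset.sum_nonneg fun j _ => sq_nonneg _).trans (hB 0)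
  refine (dirichletEnergy_le (hu.cutoff hU hχ) rfl).trans ?_
  rw [gpFunctional, gpFunctional, mass, ← lintegral_const_mul' _ _ ENNReal.ofReal_ne_top,
    ← lintegral_const_mul' _ _ ENNReal.ofReal_ne_top, ← lintegral_add_right']
  swap
  · exact ((hu.memLp.1.norm.aemeasurable.pow_const 2).ennreal_ofReal).const_mul _
  refine lintegral_mono fun x => ?_
  simp only
  rw [← ENNReal.ofReal_mul (by positivity), ← ENNReal.ofReal_mul (by positivity),
    ← ENNReal.ofReal_add (by positivity) (by positivity)]
  refine ENNReal.ofReal_le_ofReal ?_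
  obtain ⟨h0, h1⟩ := hχ01 x
  have hχ4 : χ x ^ 4 ≤ 1 := pow_le_one₀ h0 h1
  have hj : ∀ j, ‖-Complex.I * ((χ x : ℂ) * g j x + ((partialDeriv j χ x : ℝ) : ℂ) * u x) -
      (perp x j : ℂ) * ((χ x : ℂ) * u x)‖ ^ 2 ≤
      (1 + δ) * ‖-Complex.I * g j x - (perp x j : ℂ) * u x‖ ^ 2 +
        (1 + δ⁻¹) * (partialDeriv j χ x ^ 2 * ‖u x‖ ^ 2) := by
    intro j
    set A := -Complex.I * g j x - (perp x j : ℂ) * u x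
    have e1 : -Complex.I * ((χ x : ℂ) * g j x + ((partialDeriv j χ x : ℝ) : ℂ) * u x) -
      (perp x j : ℂ) * ((χ x : ℂ) * u x) = (χ x : ℂ) * A +
        -Complex.I * (((partialDeriv j χ x : ℝ) : ℂ) * u x) := by simp only [A]; ring
    have e2 := norm_add_le ((χ x : ℂ) * A) (-Complex.I * (((partialDeriv j χ x : ℝ) : ℂ) * u x))
    have e3 : ‖-Complex.I * (((partialDeriv j χ x : ℝ) : ℂ) * u x)‖ =
        |partialDeriv j χ x| * ‖u x‖ := by simp
    have e4 : ‖(χ x : ℂ) * A‖ ≤ ‖A‖ := by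
      rw [norm_mul, Complex.norm_real, Real.norm_of_nonneg h0]
      exact mul_le_of_le_one_left (norm_nonneg _) h1
    rw [e1, ← sq_abs (partialDeriv j χ x), ← mul_pow, ← e3]
    set b := ‖-Complex.I * (((partialDeriv j χ x : ℝ) : ℂ) * u x)‖
    have e5 : ‖(χ x : ℂ) * A + -Complex.I * (((partialDeriv j χ x : ℝ) : ℂ) * u x)‖ ^ 2 ≤
        (‖A‖ + b) ^ 2 := by
      gcongr
      linarith
    refine e5.trans ?_
    -- This square is Young's inequality 2‖A‖b ≤ δ‖A‖² + b²/δ.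
    have e6 : 0 ≤ δ⁻¹ * (δ * ‖A‖ - b) ^ 2 := by positivity
    have e7 : δ⁻¹ * (δ * ‖A‖ - b) ^ 2 = δ * ‖A‖ ^ 2 - 2 * ‖A‖ * b + δ⁻¹ * b ^ 2 := by
      field_simp
      ring
    nlinarith
  have hsum := Finset.sum_le_sum fun j (_ : j ∈ Finset.univ) => hj j
  rw [Finset.sum_add_distrib, ← Finset.mul_sum, ← Finset.mul_sum, ← Finset.sum_mul] at hsum
  have hBu : (1 + δ⁻¹) * ((∑ j, partialDeriv j χ x ^ 2) * ‖u x‖ ^ 2) ≤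
      (1 + δ⁻¹) * (B * ‖u x‖ ^ 2) := by
    gcongr
    exact hB x
  have hq : ‖(χ x : ℂ) * u x‖ ^ 4 ≤ (1 + δ) * ‖u x‖ ^ 4 := by
    rw [norm_mul, Complex.norm_real, Real.norm_of_nonneg h0, mul_pow]
    gcongr
    linarith
  have hq' := mul_le_mul_of_nonneg_left hq hG
  linarith

/-- Off C one uses |u|² ≤ t|u|⁴ + 1/(4t). The quartic part is at most 2t/G times the energy density,
and the constant is integrated over U \ C only. -/
theorem mass_le_mass_cutoff_add {G : ℝ} (hG : 0 < G) {U C : Set Plane} (hC : MeasurableSet C)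
    {u : Plane → ℂ} {g : Fin 2 → Plane → ℂ} (hu : AEStronglyMeasurable u (volume.restrict U))
    {χ : Plane → ℝ} (hχ : Continuous χ) (hχC : ∀ x ∈ C, χ x = 1) {t : ℝ} (ht : 0 < t) :
    mass U u ≤ mass U (fun x => (χ x : ℂ) * u x) +
      ENNReal.ofReal (2 * t / G) * gpFunctional G U u g +
        ENNReal.ofReal (1 / (4 * t)) * volume (U \ C) := by
  have h1 : ENNReal.ofReal (1 / (4 * t)) * volume (U \ C) =
      ∫⁻ x in U, Cᶜ.indicator (fun _ => ENNReal.ofReal (1 / (4 * t))) x := by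
    rw [lintegral_indicator_const hC.compl, Measure.restrict_apply hC.compl, Set.inter_comm]
    rfl
  rw [h1, mass, mass, gpFunctional, ← lintegral_const_mul' _ _ ENNReal.ofReal_ne_top,
    ← lintegral_add_left', ← lintegral_add_right _ (measurable_const.indicator hC.compl)]
  swap
  · exact ((((Complex.continuous_ofReal.comp hχ).aestronglyMeasurable.mul
      hu).norm.aemeasurable).pow_const 2).ennreal_ofReal
  refine lintegral_mono fun x => ?_
  simp only
  by_cases hx : x ∈ C
  · simp [hx, hχC x hx]
  · rw [Set.indicator_of_mem (by simpa using hx), add_assoc]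
    refine le_add_left ?_
    have hS : 0 ≤ ∑ j, ‖-Complex.I * g j x - (perp x j : ℂ) * u x‖ ^ 2 :=
      Finset.sum_nonneg fun _ _ => by positivity
    rw [← ENNReal.ofReal_mul (by positivity), ← ENNReal.ofReal_add (by positivity) (by positivity)]
    refine ENNReal.ofReal_le_ofReal ?_
    have h2 : 2 * t / G * (1 / 2 * ((∑ j, ‖-Complex.I * g j x - (perp x j : ℂ) * u x‖ ^ 2) +
        G * ‖u x‖ ^ 4)) = t / G * (∑ j, ‖-Complex.I * g j x - (perp x j : ℂ) * u x‖ ^ 2) +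
        t * ‖u x‖ ^ 4 := by
      generalize (∑ j, ‖-Complex.I * g j x - (perp x j : ℂ) * u x‖ ^ 2) = S
      field_simp
    have h3 : 0 ≤ t / G * (∑ j, ‖-Complex.I * g j x - (perp x j : ℂ) * u x‖ ^ 2) := by positivity
    have h4 : t * ‖u x‖ ^ 4 + 1 / (4 * t) - ‖u x‖ ^ 2 = t * (‖u x‖ ^ 2 - 1 / (2 * t)) ^ 2 := by
      field_simp
      ring
    have h5 : 0 ≤ t * (‖u x‖ ^ 2 - 1 / (2 * t)) ^ 2 := by positivity
    rw [h2]
    linarith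

/-! ### Squares -/

/-- The open square with lower left corner `a` and side `ℓ`. -/
def openSquare (a : Plane) (ℓ : ℝ) : Set Plane := {x | ∀ j, x j ∈ Set.Ioo (a j) (a j + ℓ)}

/-- The points of the lattice `ℓ ℤ²`. -/
noncomputable def gridPoint (ℓ : ℝ) (k : Fin 2 → ℤ) : Plane := WithLp.toLp 2 fun j => ℓ * k j

theorem volume_setOf_coord_mem (I : Fin 2 → Set ℝ) (hI : ∀ j, MeasurableSet (I j)) :
    volume {x : Plane | ∀ j, x j ∈ I j} = ∏ j, volume (I j) := by
  rw [← volume_pi_pi, ← (PiLp.volume_preserving_ofLp (Fin 2)).measure_preimage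
    (MeasurableSet.univ_pi hI).nullMeasurableSet]
  congr 1
  ext x
  simp

theorem volume_openSquare (a : Plane) (ℓ : ℝ) :
    volume (openSquare a ℓ) = ENNReal.ofReal ℓ ^ 2 := by
  rw [openSquare, volume_setOf_coord_mem (fun j => Set.Ioo (a j) (a j + ℓ))
    (fun _ => measurableSet_Ioo)]
  simp

theorem isOpen_openSquare (a : Plane) (ℓ : ℝ) : IsOpen (openSquare a ℓ) := by
  simp only [openSquare, Set.ofPred_forall]
  exact isOpen_iInter_of_finite fun j => isOpen_Ioo.preimage (by fun_prop)

theorem openSquare_eq_preimage (a : Plane) (ℓ : ℝ) :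
    openSquare a ℓ = (fun x => x - a) ⁻¹' openSquare 0 ℓ := by
  ext x
  simp [openSquare, sub_lt_iff_lt_add']

theorem disjoint_openSquare_gridPoint {ℓ : ℝ} (hℓ : 0 < ℓ) {k k' : Fin 2 → ℤ} (h : k ≠ k') :
    Disjoint (openSquare (gridPoint ℓ k) ℓ) (openSquare (gridPoint ℓ k') ℓ) := by
  refine Set.disjoint_left.2 fun x hx hx' => h (funext fun j => ?_)
  have h1 := hx j
  have h2 := hx' j
  simp only [gridPoint, Set.mem_Ioo] at h1 h2
  have h3 : (k j : ℝ) < k' j + 1 := by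
    refine lt_of_mul_lt_mul_left ?_ hℓ.le
    linarith
  have h4 : (k' j : ℝ) < k j + 1 := by
    refine lt_of_mul_lt_mul_left ?_ hℓ.le
    linarith
  norm_cast at h3 h4
  omega

theorem volume_smul_plane (L : ℝ) (S : Set Plane) :
    volume (L • S) = ENNReal.ofReal (L ^ 2) * volume S := by
  rw [Measure.addHaar_smul, finrank_euclideanSpace_fin, abs_of_nonneg (by positivity)]

/-- A dilated open set contains disjoint grid squares of a given side covering any prescribed
compact part of it. -/
theorem eventually_exists_grid_squares {K V : Set Plane} (hK : IsCompact K) (hV : IsOpen V)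
    (hKV : K ⊆ V) {ℓ : ℝ} (hℓ : 0 < ℓ) :
    ∀ᶠ L : ℝ in atTop, ∃ s : Finset (Fin 2 → ℤ),
      (∀ k ∈ s, openSquare (gridPoint ℓ k) ℓ ⊆ L • V) ∧
        volume (L • K) ≤ s.card * ENNReal.ofReal ℓ ^ 2 := by
  obtain ⟨δ, hδ, hδV⟩ := hK.exists_cthickening_subset_open hV hKV
  -- A cell of side ℓ has diameter at most 2ℓ, hence at most δ after shrinking by L, so every cell
  -- that meets LK stays inside LV.
  filter_upwards [eventually_gt_atTop 0, eventually_ge_atTop (2 * ℓ / δ)] with L hL hLδ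
  rw [div_le_iff₀ hδ] at hLδ
  set F : Plane → Fin 2 → ℤ := fun x j => ⌊x j / ℓ⌋ with hF
  have hLK : IsCompact (L • K) := hK.smul L
  obtain ⟨R, hR⟩ := hLK.isBounded.exists_norm_le
  have hfin : (F '' (L • K)).Finite := by
    refine (Set.finite_Icc (fun _ : Fin 2 => ⌊-R / ℓ⌋) (fun _ => ⌊R / ℓ⌋)).subset ?_
    rintro _ ⟨x, hx, rfl⟩
    have hj : ∀ j, |x j| ≤ R := fun j => (PiLp.norm_apply_le x j).trans (hR x hx)
    refine ⟨fun j => Int.floor_le_floor ?_, fun j => Int.floor_le_floor ?_⟩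
    · have := (abs_le.1 (hj j)).1
      gcongr
    · have := (abs_le.1 (hj j)).2
      gcongr
  have hmem : ∀ x j, ℓ * F x j ≤ x j ∧ x j < ℓ * F x j + ℓ := by
    intro x j
    have h1 := Int.floor_le (x j / ℓ)
    have h2 := Int.lt_floor_add_one (x j / ℓ)
    rw [le_div_iff₀ hℓ] at h1
    rw [div_lt_iff₀ hℓ] at h2
    constructor <;> simp only [hF] <;> linarith
  refine ⟨hfin.toFinset, ?_, ?_⟩
  · intro k hk y hy
    obtain ⟨x, hx, rfl⟩ := hfin.mem_toFinset.1 hk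
    obtain ⟨z, hz, rfl⟩ := hx
    rw [Set.mem_smul_set_iff_inv_smul_mem₀ hL.ne']
    refine hδV (Metric.mem_cthickening_of_dist_le _ z δ K hz ?_)
    have hd : dist y (L • z) ≤ 2 * ℓ := by
      rw [EuclideanSpace.dist_eq]
      refine Real.sqrt_le_iff.2 ⟨by positivity, ?_⟩
      have hj : ∀ j, dist (y j) ((L • z) j) ^ 2 ≤ ℓ ^ 2 := by
        intro j
        rw [Real.dist_eq, sq_abs]
        have h1 := hmem (L • z) j
        have h2 := hy j
        simp only [gridPoint, Set.mem_Ioo] at h2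
        exact sq_le_sq' (by linarith) (by linarith)
      refine (Finset.sum_le_sum fun j _ => hj j).trans ?_
      simp
      nlinarith
    have h3 : dist (L⁻¹ • y) z = L⁻¹ * dist y (L • z) := by
      conv_lhs => rw [← inv_smul_smul₀ hL.ne' z]
      rw [dist_smul₀, Real.norm_of_nonneg (by positivity)]
    rw [h3, inv_mul_le_iff₀ hL]
    linarith
  -- Half-open cells cover LK; the open squares are disjoint but miss the grid lines. Both have area
  -- ℓ².
  · have hcov : L • K ⊆ ⋃ k ∈ hfin.toFinset,
        {x : Plane | ∀ j, x j ∈ Set.Ico (ℓ * (k j : ℝ)) (ℓ * k j + ℓ)} := by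
      intro x hx
      refine Set.mem_iUnion₂.2 ⟨F x, hfin.mem_toFinset.2 ⟨x, hx, rfl⟩, fun j => hmem x j⟩
    refine (measure_mono hcov).trans ((measure_biUnion_finset_le _ _).trans (le_of_eq ?_))
    have : ∀ k : Fin 2 → ℤ, volume {x : Plane | ∀ j, x j ∈ Set.Ico (ℓ * (k j : ℝ)) (ℓ * k j + ℓ)}
        = ENNReal.ofReal ℓ ^ 2 := by
      intro k
      rw [volume_setOf_coord_mem (fun j => Set.Ico (ℓ * (k j : ℝ)) (ℓ * k j + ℓ))
        (fun _ => measurableSet_Ico)]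
      simp
    rw [Finset.sum_congr rfl fun k _ => this k, Finset.sum_const, nsmul_eq_mul]

/-! ### Lipschitz boundaries are null sets -/

/-- In the coordinates of b the set is a graph over the line, with one-point vertical slices, so
Fubini applies. -/
theorem volume_graph_eq_zero (b : OrthonormalBasis (Fin 2) ℝ Plane) (p : Plane) {γ : ℝ → ℝ}
    (hγ : Continuous γ) :
    volume {x : Plane | γ (inner ℝ (b 0) (x - p)) = inner ℝ (b 1) (x - p)} = 0 := by
  have h0 : volume {q : ℝ × ℝ | γ q.1 = q.2} = 0 := by
    have hm : MeasurableSet {q : ℝ × ℝ | γ q.1 = q.2} :=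
      (isClosed_eq (hγ.comp continuous_fst) continuous_snd).measurableSet
    rw [Measure.volume_eq_prod, Measure.measure_prod_null hm]
    refine Eventually.of_forall fun x => ?_
    have : Prod.mk x ⁻¹' {q : ℝ × ℝ | γ q.1 = q.2} = {γ x} := by
      ext y
      simp [eq_comm]
    simp [this]
  have hmp : MeasurePreserving (fun x : Plane =>
      MeasurableEquiv.finTwoArrow (WithLp.ofLp (b.repr (x - p)))) volume volume :=
    (volume_preserving_finTwoArrow ℝ).comp ((PiLp.volume_preserving_ofLp (Fin 2)).comp
      (b.measurePreserving_repr.comp (measurePreserving_sub_right volume p)))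
  have := hmp.quasiMeasurePreserving.preimage_null h0
  convert this using 2
  ext x
  simp [b.repr_apply_apply, inner_sub_right]

/-- Points strictly above the local graph are interior and points strictly below are exterior, so
near p the frontier lies on the graph. -/
theorem HasLipschitzBoundary.volume_frontier {D : Set Plane} (hD : HasLipschitzBoundary D) :
    volume (frontier D) = 0 := by
  refine measure_null_of_locally_null _ fun p hp => ?_
  obtain ⟨b, r, K, γ, hr, hγ, h⟩ := hD p hp
  refine ⟨frontier D ∩ Metric.ball p r,
    inter_mem self_mem_nhdsWithin (mem_nhdsWithin_of_mem_nhds (Metric.ball_mem_nhds p hr)),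
    measure_mono_null ?_ (volume_graph_eq_zero b p hγ.continuous)⟩
  rintro x ⟨hxD, hxr⟩
  have hball : Metric.ball p r ∈ 𝓝 x := Metric.isOpen_ball.mem_nhds hxr
  have c1 : Continuous fun x => γ (inner ℝ (b 0) (x - p)) := by
    have := hγ.continuous
    fun_prop
  have c2 : Continuous fun x => inner ℝ (b 1) (x - p) := by fun_prop
  rcases lt_trichotomy (γ (inner ℝ (b 0) (x - p))) (inner ℝ (b 1) (x - p)) with hlt | heq | hgt
  · refine absurd (mem_interior_iff_mem_nhds.2 ?_) hxD.2
    filter_upwards [hball, (isOpen_lt c1 c2).mem_nhds hlt] with y hy hy'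
    exact (h y hy).2 hy'
  · exact heq
  · refine absurd hxD.1 fun hcl => ?_
    obtain ⟨y, ⟨hy, hy'⟩, hyD⟩ := mem_closure_iff_nhds.1 hcl _
      (inter_mem hball ((isOpen_lt c2 c1).mem_nhds hgt))
    exact lt_asymm hy' ((h y hy).1 hyD)

/-! ### Cutoff functions -/

theorem exists_cutoff {C U : Set Plane} (hC : IsCompact C) (hU : IsOpen U) (hCU : C ⊆ U) :
    ∃ η : Plane → ℝ, IsTestFunction U η ∧ (∀ x, η x ∈ Set.Icc (0 : ℝ) 1) ∧ ∀ x ∈ C, η x = 1 := by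
  -- The support of η will be V itself; compactness of its closure inside U makes η a test function
  -- on U.
  obtain ⟨V, hV, hCV, hVU, hVc⟩ := exists_open_between_and_isCompact_closure hC hU hCU
  obtain ⟨f, hf, hr, hs, h1⟩ := exists_contMDiff_support_eq_eq_one_iff
    (modelWithCornersSelf ℝ Plane) (n := ⊤) hV hC.isClosed hCV
  refine ⟨f, ⟨hf.contDiff, ?_, ?_⟩, fun x => hr ⟨x, rfl⟩, fun x hx => (h1 x).1 hx⟩
  · rw [HasCompactSupport, tsupport, hs]
    exact hVc
  · rw [tsupport, hs]
    exact hVU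

theorem IsTestFunction.comp_smul {U : Set Plane} {η : Plane → ℝ} (hη : IsTestFunction U η) {L : ℝ}
    (hL : 0 < L) : IsTestFunction (L • U) fun x => η (L⁻¹ • x) := by
  have hL' : L⁻¹ ≠ 0 := inv_ne_zero hL.ne'
  refine ⟨hη.smooth.comp (contDiff_const_smul _),
    hη.compact.comp_homeomorph (Homeomorph.smulOfNeZero L⁻¹ hL'), ?_⟩
  have := tsupport_comp_eq_preimage η (Homeomorph.smulOfNeZero L⁻¹ hL')
  refine this.subset.trans fun x hx => ?_
  rw [Set.mem_smul_set_iff_inv_smul_mem₀ hL.ne']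
  exact hη.support_subset hx

theorem partialDeriv_comp_smul {η : Plane → ℝ} (hη : Differentiable ℝ η) (c : ℝ) (j : Fin 2)
    (x : Plane) : partialDeriv j (fun x => η (c • x)) x = c * partialDeriv j η (c • x) := by
  have h : fderiv ℝ (fun x => η (c • x)) x =
      (fderiv ℝ η (c • x)).comp (c • ContinuousLinearMap.id ℝ Plane) :=
    ((hη (c • x)).hasFDerivAt.comp x ((hasFDerivAt_id x).const_smul c)).fderiv
  simp [partialDeriv, h]

/-! ### Energies of squares and tilings -/

theorem dirichletEnergy_mono_set (G : ℝ) {U W : Set Plane} (hU : MeasurableSet U) (hUW : U ⊆ W)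
    (M : ℝ≥0∞) : dirichletEnergy G W M ≤ dirichletEnergy G U M := by
  simpa [dirichletEnergy_empty] using dirichletEnergy_add_le G hU MeasurableSet.empty
    (Set.disjoint_empty U) hUW (Set.empty_subset W) M 0

/-- Stands in for continuity of the energy in the mass: an error in the mass by a factor at most c
costs at most c². -/
theorem dirichletEnergy_le_of_mass_le (G : ℝ) (U : Set Plane) {M₁ M₂ : ℝ≥0∞} {c : ℝ}
    (h0 : M₁ ≠ 0) (hM : M₂ ≠ ⊤) (h12 : M₁ ≤ M₂) (h21 : M₂ ≤ ENNReal.ofReal c * M₁) :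
    dirichletEnergy G U M₂ ≤ ENNReal.ofReal (c ^ 2) * dirichletEnergy G U M₁ := by
  have h1t : M₁ ≠ ⊤ := (h12.trans_lt hM.lt_top).ne
  have hdt : M₂ / M₁ ≠ ⊤ := ENNReal.div_ne_top hM h0
  have h1 : 1 ≤ (M₂ / M₁).toReal := by
    rw [← ENNReal.ofReal_le_iff_le_toReal hdt, ENNReal.ofReal_one,
      ENNReal.le_div_iff_mul_le (Or.inl h0) (Or.inl h1t), one_mul]
    exact h12
  have h2 : (M₂ / M₁).toReal ≤ c := by
    have h3 : M₂ / M₁ ≤ ENNReal.ofReal c := ENNReal.div_le_of_le_mul h21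
    by_contra hc
    rw [not_le] at hc
    have := (ENNReal.ofReal_lt_ofReal_iff (by linarith)).2 hc
    rw [ENNReal.ofReal_toReal hdt] at this
    exact absurd h3 this.not_ge
  have h4 : M₂ = ENNReal.ofReal (M₂ / M₁).toReal * M₁ := by
    rw [ENNReal.ofReal_toReal hdt, ENNReal.div_mul_cancel h0 h1t]
  conv_lhs => rw [h4]
  refine (dirichletEnergy_mul_le G U M₁ h1).trans ?_
  gcongr

theorem dirichletEnergy_openSquare (G : ℝ) (a : Plane) (ℓ : ℝ) (M : ℝ≥0∞) :
    dirichletEnergy G (openSquare a ℓ) M = dirichletEnergy G (openSquare 0 ℓ) M := by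
  refine le_antisymm ?_ ?_
  · rw [openSquare_eq_preimage a]
    exact dirichletEnergy_translate_le G (isOpen_openSquare 0 ℓ).measurableSet a M
  · have : openSquare 0 ℓ = (fun x => x - (-a)) ⁻¹' openSquare a ℓ := by
      rw [openSquare_eq_preimage a]
      ext x
      simp
    rw [this]
    exact dirichletEnergy_translate_le G (isOpen_openSquare a ℓ).measurableSet (-a) M

/-- The Dirichlet energy per unit area of the square of side `ℓ` at density `ϱ`. -/
noncomputable def squareEnergyDensity (G ϱ ℓ : ℝ) : ℝ≥0∞ :=
  dirichletEnergy G (openSquare 0 ℓ) (ENNReal.ofReal ϱ * ENNReal.ofReal ℓ ^ 2) /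
    ENNReal.ofReal ℓ ^ 2

theorem ofReal_sq_ne_zero {ℓ : ℝ} (hℓ : 0 < ℓ) : ENNReal.ofReal ℓ ^ 2 ≠ 0 := by
  simpa using hℓ

theorem ofReal_sq_ne_top (ℓ : ℝ) : ENNReal.ofReal ℓ ^ 2 ≠ ⊤ := by simp

theorem dirichletEnergy_openSquare_eq (G ϱ : ℝ) (a : Plane) {ℓ : ℝ} (hℓ : 0 < ℓ) :
    dirichletEnergy G (openSquare a ℓ) (ENNReal.ofReal ϱ * ENNReal.ofReal ℓ ^ 2) =
      squareEnergyDensity G ϱ ℓ * ENNReal.ofReal ℓ ^ 2 := by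
  rw [dirichletEnergy_openSquare, squareEnergyDensity,
    ENNReal.div_mul_cancel (ofReal_sq_ne_zero hℓ) (ofReal_sq_ne_top ℓ)]

theorem pairwiseDisjoint_gridSquares {ℓ : ℝ} (hℓ : 0 < ℓ) (s : Set (Fin 2 → ℤ)) :
    s.PairwiseDisjoint fun k => openSquare (gridPoint ℓ k) ℓ :=
  fun _ _ _ _ h => disjoint_openSquare_gridPoint hℓ h

theorem dirichletEnergy_gridSquares_le (G ϱ : ℝ) {ℓ : ℝ} (hℓ : 0 < ℓ) (s : Finset (Fin 2 → ℤ)) :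
    dirichletEnergy G (⋃ k ∈ s, openSquare (gridPoint ℓ k) ℓ)
        (ENNReal.ofReal ϱ * (s.card * ENNReal.ofReal ℓ ^ 2)) ≤
      s.card * ENNReal.ofReal ℓ ^ 2 * squareEnergyDensity G ϱ ℓ := by
  have := dirichletEnergy_biUnion_le G s (fun k => openSquare (gridPoint ℓ k) ℓ)
    (fun _ => ENNReal.ofReal ϱ * ENNReal.ofReal ℓ ^ 2)
    (fun k => (isOpen_openSquare _ _).measurableSet) (pairwiseDisjoint_gridSquares hℓ _)
  simp only [dirichletEnergy_openSquare_eq G ϱ _ hℓ, Finset.sum_const, nsmul_eq_mul] at this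
  convert this using 1
  · congr 1; ring
  · ring

theorem card_mul_le_volume {ℓ : ℝ} (hℓ : 0 < ℓ) {s : Finset (Fin 2 → ℤ)} {V : Set Plane}
    (hV : ∀ k ∈ s, openSquare (gridPoint ℓ k) ℓ ⊆ V) :
    s.card * ENNReal.ofReal ℓ ^ 2 ≤ volume V := by
  have h := measure_biUnion_finset (μ := (volume : Measure Plane))
    (pairwiseDisjoint_gridSquares hℓ (s : Set (Fin 2 → ℤ)))
    (fun k _ => (isOpen_openSquare _ _).measurableSet)
  simp only [volume_openSquare, Finset.sum_const, nsmul_eq_mul] at h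
  rw [← h]
  exact measure_mono (Set.iUnion₂_subset hV)

/-! ### Bounds for dilated domains by filling with squares -/

/-- Inner regularity in multiplicative form, as the mass-scaling estimate requires. -/
theorem IsOpen.exists_isCompact_volume_le_mul {V : Set Plane} (hV : IsOpen V)
    (hVt : volume V ≠ ⊤) {s : ℝ} (hs : 0 < s) :
    ∃ K ⊆ V, IsCompact K ∧ volume V ≤ ENNReal.ofReal (1 + s) * volume K := by
  rcases eq_or_ne (volume V) 0 with h0 | h0
  · exact ⟨∅, Set.empty_subset _, isCompact_empty, by simp [h0]⟩
  have h1 : (1 : ℝ≥0∞) < ENNReal.ofReal (1 + s) := by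
    rw [← ENNReal.ofReal_one]
    exact (ENNReal.ofReal_lt_ofReal_iff (by linarith)).2 (by linarith)
  have h2 : volume V / ENNReal.ofReal (1 + s) < volume V := by
    refine ENNReal.div_lt_of_lt_mul' ?_
    simpa using ENNReal.mul_lt_mul_left h0 hVt h1
  obtain ⟨K, hKV, hK, hlt⟩ := hV.exists_lt_isCompact h2
  refine ⟨K, hKV, hK, ?_⟩
  rw [← ENNReal.div_le_iff' (by positivity) ENNReal.ofReal_ne_top]
  exact hlt.le

theorem volume_smul_ne_zero {D : Set Plane} (hD : volume D ≠ 0) {L : ℝ} (hL : 0 < L) :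
    volume (L • D) ≠ 0 := by
  rw [volume_smul_plane]
  exact mul_ne_zero (by simpa using hL.ne') hD

theorem volume_smul_ne_top {D : Set Plane} (hD : volume D ≠ ⊤) (L : ℝ) :
    volume (L • D) ≠ ⊤ := by
  rw [volume_smul_plane]
  exact ENNReal.mul_ne_top ENNReal.ofReal_ne_top hD

/-- Upper bound: fill the dilated domain with squares. -/
theorem eventually_dirichletEnergy_div_le (G : ℝ) {ϱ : ℝ} (hϱ : 0 < ϱ) {D : Set Plane}
    (hD : IsOpen D) (hD0 : volume D ≠ 0) (hDt : volume D ≠ ⊤) {ℓ s : ℝ} (hℓ : 0 < ℓ) (hs : 0 < s) :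
    ∀ᶠ L : ℝ in atTop,
      dirichletEnergy G (L • D) (ENNReal.ofReal ϱ * volume (L • D)) / volume (L • D) ≤
        ENNReal.ofReal ((1 + s) ^ 2) * squareEnergyDensity G ϱ ℓ := by
  obtain ⟨K, hKD, hK, hKv⟩ := hD.exists_isCompact_volume_le_mul hDt hs
  filter_upwards [eventually_exists_grid_squares hK hD hKD hℓ, eventually_gt_atTop 0]
    with L ⟨t, ht, hcard⟩ hL
  have hle := card_mul_le_volume hℓ ht
  have hge : volume (L • D) ≤ ENNReal.ofReal (1 + s) * (t.card * ENNReal.ofReal ℓ ^ 2) := by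
    refine le_trans ?_ (mul_le_mul_right hcard _)
    rw [volume_smul_plane, volume_smul_plane, mul_left_comm]
    gcongr
  have hϱ0 : ENNReal.ofReal ϱ ≠ 0 := by simpa using hϱ
  have hN0 : (t.card * ENNReal.ofReal ℓ ^ 2 : ℝ≥0∞) ≠ 0 := by
    intro h
    rw [h, mul_zero] at hge
    exact volume_smul_ne_zero hD0 hL (le_antisymm hge zero_le)
  refine ENNReal.div_le_of_le_mul ?_
  -- The squares carry slightly too little mass; scaling up by at most 1 + s corrects this.
  calc _ ≤ ENNReal.ofReal ((1 + s) ^ 2) * dirichletEnergy G (L • D)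
        (ENNReal.ofReal ϱ * (t.card * ENNReal.ofReal ℓ ^ 2)) := by
        refine dirichletEnergy_le_of_mass_le G _ (mul_ne_zero hϱ0 hN0)
          (ENNReal.mul_ne_top ENNReal.ofReal_ne_top (volume_smul_ne_top hDt L)) (by gcongr) ?_
        rw [mul_left_comm]
        gcongr
    _ ≤ ENNReal.ofReal ((1 + s) ^ 2) *
        (t.card * ENNReal.ofReal ℓ ^ 2 * squareEnergyDensity G ϱ ℓ) := by
        gcongr
        refine (dirichletEnergy_mono_set G (t.measurableSet_biUnion fun k _ =>
          (isOpen_openSquare _ _).measurableSet) (Set.iUnion₂_subset ht) _).trans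
          (dirichletEnergy_gridSquares_le G ϱ hℓ t)
    _ ≤ ENNReal.ofReal ((1 + s) ^ 2) * (volume (L • D) * squareEnergyDensity G ϱ ℓ) := by
        gcongr
    _ = _ := by ring

theorem smul_openSquare {L : ℝ} (hL : 0 < L) (a : Plane) (κ : ℝ) :
    L • openSquare a κ = openSquare (L • a) (L * κ) := by
  ext x
  rw [Set.mem_smul_set_iff_inv_smul_mem₀ hL.ne']
  refine forall_congr' fun j => ?_
  simp only [PiLp.smul_apply, smul_eq_mul, Set.mem_Ioo, ← mul_add]
  rw [lt_inv_mul_iff₀ hL, inv_mul_lt_iff₀ hL]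

/-- Lower bound: place the dilated domain into a large square and fill the complement with
squares. -/
theorem eventually_mul_iInf_squareEnergyDensity_le (G : ℝ) {ϱ : ℝ} (hϱ : 0 < ϱ) {D : Set Plane}
    (hD : IsOpen D) (hD0 : volume D ≠ 0) (hDf : volume (frontier D) = 0) {a : Plane} {κ : ℝ}
    (hκ : 0 < κ) (hDW : closure D ⊆ openSquare a κ) {ℓ s : ℝ} (hℓ : 0 < ℓ) (hs : 0 < s) :
    ∀ᶠ L : ℝ in atTop,
      volume (openSquare a κ) * (⨅ r : Set.Ioi (0 : ℝ), squareEnergyDensity G ϱ r) ≤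
        ENNReal.ofReal ((1 + s) ^ 2) * (volume D *
          (dirichletEnergy G (L • D) (ENNReal.ofReal ϱ * volume (L • D)) / volume (L • D)) +
            volume (openSquare a κ \ closure D) * squareEnergyDensity G ϱ ℓ) := by
  set W := openSquare a κ with hW
  have hWo : IsOpen W := isOpen_openSquare a κ
  have hWt : volume W ≠ ⊤ := by rw [hW, volume_openSquare]; exact ofReal_sq_ne_top κ
  set V := W \ closure D with hV
  have hVo : IsOpen V := hWo.sdiff isClosed_closure
  have hVW : V ⊆ W := Set.sdiff_subset
  have hDWs : D ⊆ W := subset_closure.trans hDW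
  have hVt : volume V ≠ ⊤ := measure_ne_top_of_subset hVW hWt
  have hDt : volume D ≠ ⊤ := measure_ne_top_of_subset hDWs hWt
  -- The null frontier enters here: D and V together have the full area of W.
  have hWle : volume W ≤ volume D + volume V := by
    have hsub : W ⊆ (D ∪ frontier D) ∪ V := by
      intro x hx
      by_cases hxD : x ∈ closure D
      · left
        rw [← closure_eq_self_union_frontier]
        exact hxD
      · exact Or.inr ⟨hx, hxD⟩
    have hcl : volume (D ∪ frontier D) ≤ volume D :=
      (measure_union_le D (frontier D)).trans (by rw [hDf, add_zero])
    exact (measure_mono hsub).trans ((measure_union_le _ _).trans (add_le_add hcl le_rfl))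
  obtain ⟨K, hKV, hK, hKv⟩ := hVo.exists_isCompact_volume_le_mul hVt hs
  have hc1 : (1 : ℝ≥0∞) ≤ ENNReal.ofReal (1 + s) := by
    rw [← ENNReal.ofReal_one]
    exact ENNReal.ofReal_le_ofReal (by linarith)
  have hWK : volume W ≤ ENNReal.ofReal (1 + s) * (volume D + volume K) := by
    refine hWle.trans ?_
    rw [mul_add]
    gcongr
    exact le_mul_of_one_le_left zero_le hc1
  filter_upwards [eventually_exists_grid_squares hK hVo hKV hℓ, eventually_gt_atTop 0]
    with L ⟨t, ht, hcard⟩ hL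
  have hle := card_mul_le_volume hℓ ht
  set N : ℝ≥0∞ := t.card * ENNReal.ofReal ℓ ^ 2 with hN
  set Q := ⋃ k ∈ t, openSquare (gridPoint ℓ k) ℓ with hQ
  have hQm : MeasurableSet Q :=
    t.measurableSet_biUnion fun k _ => (isOpen_openSquare _ _).measurableSet
  have hQV : Q ⊆ L • V := Set.iUnion₂_subset ht
  have hLD : IsOpen (L • D) := hD.smul₀ hL.ne'
  have hDV : Disjoint (L • D) (L • V) := by
    refine Set.disjoint_left.2 fun x hx hx' => ?_
    rw [Set.mem_smul_set_iff_inv_smul_mem₀ hL.ne'] at hx hx'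
    exact hx'.2 (subset_closure hx)
  have hdisj : Disjoint (L • D) Q := hDV.mono_right hQV
  have hsub : volume (L • D) + N ≤ volume (L • W) := by
    calc volume (L • D) + N ≤ volume (L • D) + volume (L • V) := by gcongr
      _ = volume (L • D ∪ L • V) := (measure_union hDV (hVo.smul₀ hL.ne').measurableSet).symm
      _ ≤ volume (L • W) := measure_mono
        (Set.union_subset (Set.smul_set_mono hDWs) (Set.smul_set_mono hVW))
  have hsup : volume (L • W) ≤ ENNReal.ofReal (1 + s) * (volume (L • D) + N) := by
    refine le_trans ?_ (mul_le_mul_right (add_le_add_right hcard _) _)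
    rw [volume_smul_plane, volume_smul_plane, volume_smul_plane, ← mul_add, mul_left_comm]
    gcongr
  have hϱ0 : ENNReal.ofReal ϱ ≠ 0 := by simpa using hϱ
  have hLD0 := volume_smul_ne_zero hD0 hL
  have hLDt := volume_smul_ne_top hDt L
  have hmain : volume (L • W) * (⨅ r : Set.Ioi (0 : ℝ), squareEnergyDensity G ϱ r) ≤
      ENNReal.ofReal ((1 + s) ^ 2) *
        (volume (L • D) * (dirichletEnergy G (L • D) (ENNReal.ofReal ϱ * volume (L • D)) /
          volume (L • D)) + volume (L • V) * squareEnergyDensity G ϱ ℓ) := by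
    have hLκ : 0 < L * κ := by positivity
    -- LW is itself a square, of side Lκ, so its energy density is one of those in the infimum.
    calc volume (L • W) * (⨅ r : Set.Ioi (0 : ℝ), squareEnergyDensity G ϱ r)
        ≤ volume (L • W) * squareEnergyDensity G ϱ (L * κ) := by
          gcongr
          exact iInf_le (fun r : Set.Ioi (0 : ℝ) => squareEnergyDensity G ϱ r) ⟨L * κ, hLκ⟩
      _ = dirichletEnergy G (L • W) (ENNReal.ofReal ϱ * volume (L • W)) := by
          rw [hW, smul_openSquare hL, volume_openSquare,
            dirichletEnergy_openSquare_eq G ϱ _ hLκ, mul_comm]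
      _ ≤ ENNReal.ofReal ((1 + s) ^ 2) * dirichletEnergy G (L • W)
          (ENNReal.ofReal ϱ * (volume (L • D) + N)) := by
          refine dirichletEnergy_le_of_mass_le G _
            (mul_ne_zero hϱ0 fun h => hLD0 (add_eq_zero.1 h).1)
            (ENNReal.mul_ne_top ENNReal.ofReal_ne_top (volume_smul_ne_top hWt L)) (by gcongr) ?_
          rw [mul_left_comm]
          gcongr
      _ ≤ ENNReal.ofReal ((1 + s) ^ 2) * (dirichletEnergy G (L • D)
          (ENNReal.ofReal ϱ * volume (L • D)) + N * squareEnergyDensity G ϱ ℓ) := by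
          gcongr
          rw [mul_add]
          refine (dirichletEnergy_add_le G hLD.measurableSet hQm hdisj (Set.smul_set_mono hDWs)
            (hQV.trans (Set.smul_set_mono hVW)) _ _).trans ?_
          gcongr
          exact dirichletEnergy_gridSquares_le G ϱ hℓ t
      _ ≤ _ := by
          rw [ENNReal.mul_div_cancel hLD0 hLDt]
          gcongr
  rw [volume_smul_plane L W, volume_smul_plane L V] at hmain
  -- Only the area in front of the quotient is expanded, so that L² cancels while the energy density
  -- of LD stays intact.
  conv_rhs at hmain =>
    enter [2, 1, 1]
    rw [volume_smul_plane L D]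
  have hL2 : ENNReal.ofReal (L ^ 2) ≠ 0 := by simpa using hL.ne'
  refine (ENNReal.mul_le_mul_iff_right hL2 ENNReal.ofReal_ne_top).1 ?_
  convert hmain using 1 <;> ring

/-! ### Comparison of Neumann and Dirichlet energies -/

/-- The Dirichlet energy is controlled by the Neumann energy up to an arbitrarily small error. -/
theorem eventually_dirichletEnergy_div_le_of_neumannEnergy {G ϱ : ℝ} (hG : 0 < G) (hϱ : 0 < ϱ)
    {D : Set Plane} (hD : IsOpen D) (hD0 : volume D ≠ 0) (hDt : volume D ≠ ⊤) {b s : ℝ}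
    (hb : 0 ≤ b) (hs : 0 < s) (hs1 : s < 1) :
    ∀ᶠ L : ℝ in atTop,
      neumannEnergy G (L • D) (ENNReal.ofReal ϱ * volume (L • D)) / volume (L • D) ≤
          ENNReal.ofReal b →
        dirichletEnergy G (L • D) (ENNReal.ofReal ϱ * volume (L • D)) / volume (L • D) ≤
          ENNReal.ofReal ((1 - s)⁻¹ ^ 2 * ((1 + s) * (b + s) + s)) := by
  set v : ℝ := (volume D).toReal with hv
  have hvD : volume D = ENNReal.ofReal v := (ENNReal.ofReal_toReal hDt).symm
  have hv0 : 0 < v := ENNReal.toReal_pos hD0 hDt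
  -- The allowed mass loss is a fraction s. This t gives half of it to the quartic term, at energy
  -- density b + s; the area of D \ C is then chosen so that the constant term takes the other half.
  obtain ⟨t, ht, htb⟩ : ∃ t : ℝ, 0 < t ∧ 2 * t / G * (b + s) = ϱ * s / 2 :=
    ⟨ϱ * s * G / (4 * (b + s)), by positivity, by field_simp; norm_num⟩
  obtain ⟨C, hCD, hC, hCv⟩ := hD.measurableSet.exists_isCompact_sdiff_lt hDt
    (ε := ENNReal.ofReal (2 * t * ϱ * v * s)) (by
      have : 0 < 2 * t * ϱ * v * s := by positivity
      simpa using this)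
  obtain ⟨η, hη, hη01, hηC⟩ := exists_cutoff hC hD hCD
  obtain ⟨B, hB⟩ : ∃ B : ℝ, ∀ x, ∑ j, partialDeriv j η x ^ 2 ≤ B := by
    have h1 : ∀ j, ∃ b : ℝ, ∀ x, ‖partialDeriv j η x‖ ≤ b := fun j =>
      (hη.continuous_partialDeriv j).bounded_above_of_compact_support
        (hη.hasCompactSupport_partialDeriv j)
    choose β hβ using h1
    refine ⟨∑ j, β j ^ 2, fun x => Finset.sum_le_sum fun j _ => ?_⟩
    exact sq_le_sq' (abs_le.1 (hβ j x)).1 (abs_le.1 (hβ j x)).2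
  have hlim : Tendsto (fun L : ℝ => (1 + s⁻¹) * (L⁻¹ ^ 2 * B) / 2 * ϱ) atTop (𝓝 0) := by
    have := (((tendsto_inv_atTop_zero (𝕜 := ℝ)).pow 2).mul_const B).const_mul (1 + s⁻¹)
    simpa using (this.div_const 2).mul_const ϱ
  filter_upwards [hlim.eventually_le_const hs, eventually_gt_atTop 0] with L hLs hL hn
  have hL' : L ≠ 0 := hL.ne'
  set A : ℝ := L ^ 2 * v with hA
  have hA0 : 0 < A := by positivity
  have hvol : volume (L • D) = ENNReal.ofReal A := by
    rw [volume_smul_plane, hvD, ← ENNReal.ofReal_mul (by positivity)]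
  have hvol0 : volume (L • D) ≠ 0 := volume_smul_ne_zero hD0 hL
  have hvolt : volume (L • D) ≠ ⊤ := volume_smul_ne_top hDt L
  set M := ENNReal.ofReal ϱ * volume (L • D) with hM
  have hMA : M = ENNReal.ofReal (ϱ * A) := by rw [hM, hvol, ← ENNReal.ofReal_mul hϱ.le]
  -- The slack s in b + s provides a near-minimiser, so no minimiser has to exist.
  have hlt : neumannEnergy G (L • D) M < ENNReal.ofReal ((b + s) * A) := by
    rw [ENNReal.div_le_iff hvol0 hvolt, hvol, ← ENNReal.ofReal_mul hb] at hn
    refine hn.trans_lt ((ENNReal.ofReal_lt_ofReal_iff (by positivity)).2 ?_)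
    gcongr
    linarith
  obtain ⟨_, ⟨u, g, hu, huM, rfl⟩, hE⟩ := sInf_lt_iff.1 hlt
  have hLo : IsOpen (L • D) := hD.smul₀ hL'
  -- The cutoff is dilated with the domain, so |∇χ|² = O(L⁻²) while the discarded fraction of the
  -- area does not depend on L.
  set χ : Plane → ℝ := fun x => η (L⁻¹ • x) with hχdef
  have hχ : IsTestFunction (L • D) χ := hη.comp_smul hL
  have hχB : ∀ x, ∑ j, partialDeriv j χ x ^ 2 ≤ L⁻¹ ^ 2 * B := by
    intro x
    simp only [hχdef, partialDeriv_comp_smul hη.differentiable, mul_pow, ← Finset.mul_sum]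
    gcongr
    exact hB _
  have hcut := dirichletEnergy_cutoff_le hG.le hLo hu hχ (fun x => hη01 _) hχB hs
  have hmass := mass_le_mass_cutoff_add (χ := χ) hG (hC.smul L).measurableSet hu.memLp.1
    hχ.continuous (g := g) (fun x hx => hηC _ ((Set.mem_smul_set_iff_inv_smul_mem₀ hL' _ _).1 hx)) ht
  rw [huM] at hcut hmass
  set m := mass (L • D) fun x => (χ x : ℂ) * u x with hm
  have hmM : m ≤ M := by
    rw [← huM]
    have hle : ∀ x, ‖(χ x : ℂ) * u x‖ ≤ ‖u x‖ := fun x => by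
      rw [norm_mul, Complex.norm_real, Real.norm_of_nonneg (hη01 _).1]
      exact mul_le_of_le_one_left (norm_nonneg _) (hη01 _).2
    refine lintegral_mono fun x => ENNReal.ofReal_le_ofReal ?_
    gcongr
    exact hle x
  have hdiff : volume (L • D \ L • C) ≤ ENNReal.ofReal (2 * t * ϱ * A * s) := by
    rw [← Set.smul_set_sdiff₀ hL', volume_smul_plane]
    refine (mul_le_mul_right hCv.le _).trans (le_of_eq ?_)
    rw [← ENNReal.ofReal_mul (by positivity)]
    congr 1
    rw [hA]
    ring
  have hmt : m ≠ ⊤ := (hmM.trans_lt (by rw [hMA]; exact ENNReal.ofReal_lt_top)).ne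
  have hmlow : (1 - s) * (ϱ * A) ≤ m.toReal := by
    have h1 : ENNReal.ofReal (ϱ * A) ≤ ENNReal.ofReal (m.toReal + 2 * t / G * ((b + s) * A) +
        1 / (4 * t) * (2 * t * ϱ * A * s)) := by
      rw [ENNReal.ofReal_add (by positivity) (by positivity),
        ENNReal.ofReal_add (by positivity) (by positivity), ENNReal.ofReal_toReal hmt,
        ENNReal.ofReal_mul (p := 2 * t / G) (by positivity),
        ENNReal.ofReal_mul (p := 1 / (4 * t)) (by positivity), ← hMA]
      refine hmass.trans ?_
      gcongr
    rw [ENNReal.ofReal_le_ofReal_iff (by positivity)] at h1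
    have h2 : 1 / (4 * t) * (2 * t * ϱ * A * s) = ϱ * A * s / 2 := by
      field_simp
      norm_num
    have h3 : 2 * t / G * ((b + s) * A) = ϱ * s / 2 * A := by rw [← htb]; ring
    rw [h2, h3] at h1
    linarith
  have h1s : 0 < 1 - s := by linarith
  have hm0 : m ≠ 0 := by
    intro h
    rw [h, ENNReal.toReal_zero] at hmlow
    have : 0 < (1 - s) * (ϱ * A) := by positivity
    linarith
  have hMm : M ≤ ENNReal.ofReal (1 - s)⁻¹ * m := by
    rw [← ENNReal.ofReal_toReal hmt, ← ENNReal.ofReal_mul (by positivity), hMA]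
    refine ENNReal.ofReal_le_ofReal ?_
    rwa [le_inv_mul_iff₀ h1s]
  refine ENNReal.div_le_of_le_mul ?_
  refine (dirichletEnergy_le_of_mass_le G _ hm0 (by rw [hMA]; exact ENNReal.ofReal_ne_top)
    hmM hMm).trans ?_
  rw [hvol, ENNReal.ofReal_mul (p := (1 - s)⁻¹ ^ 2) (by positivity), mul_assoc]
  gcongr
  rw [← ENNReal.ofReal_mul (by positivity)]
  calc _ ≤ _ := hcut
    _ ≤ ENNReal.ofReal (1 + s) * ENNReal.ofReal ((b + s) * A) +
        ENNReal.ofReal ((1 + s⁻¹) * (L⁻¹ ^ 2 * B) / 2) * M := by gcongr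
    _ = ENNReal.ofReal ((1 + s) * ((b + s) * A) + (1 + s⁻¹) * (L⁻¹ ^ 2 * B) / 2 * (ϱ * A)) := by
        have hB0 : 0 ≤ B := (Finset.sum_nonneg fun j _ => sq_nonneg _).trans (hB 0)
        rw [hMA, ← ENNReal.ofReal_mul (by positivity), ← ENNReal.ofReal_mul (by positivity),
          ← ENNReal.ofReal_add (by positivity) (by positivity)]
    _ ≤ _ := by
        refine ENNReal.ofReal_le_ofReal ?_
        have := mul_le_mul_of_nonneg_right hLs hA0.le
        linarith

/-! ### The thermodynamic limit -/

/-- A bump function in the unit square, rescaled to mass ϱ, has finite energy. This makes the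
infimum over squares finite. -/
theorem squareEnergyDensity_one_ne_top (G : ℝ) {ϱ : ℝ} (hϱ : 0 < ϱ) :
    squareEnergyDensity G ϱ 1 ≠ ⊤ := by
  set S := openSquare 0 1 with hS
  have hSo : IsOpen S := isOpen_openSquare 0 1
  obtain ⟨C, hCS, hC, hC0⟩ := hSo.exists_lt_isCompact (μ := volume) (r := 0)
    (by simp [hS, volume_openSquare])
  obtain ⟨η, hη, hη01, hηC⟩ := exists_cutoff hC hSo hCS
  set φ : Plane → ℂ := fun x => (η x : ℂ) with hφdef
  have hφ : IsTestFunction S φ := ⟨Complex.ofRealCLM.contDiff.comp hη.smooth,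
    hη.compact.comp_left Complex.ofReal_zero,
    (closure_mono (Function.support_comp_subset Complex.ofReal_zero η)).trans hη.support_subset⟩
  have hfin : ∀ F : Plane → ℝ, Continuous F → HasCompactSupport F →
      ∫⁻ x in S, ENNReal.ofReal (F x) ≠ ⊤ := fun F hF hFc =>
    ((hF.integrable_of_hasCompactSupport hFc).integrableOn.lintegral_lt_top).ne
  have hm0 : mass S φ ≠ 0 := by
    have h1 : volume C ≤ mass S φ := by
      calc volume C = ∫⁻ x in C, 1 := by simp
        _ = ∫⁻ x in C, ENNReal.ofReal (‖φ x‖ ^ 2) :=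
          setLIntegral_congr_fun hC.measurableSet fun x hx => by simp [hφdef, hηC x hx]
        _ ≤ mass S φ := lintegral_mono_set hCS
    exact (hC0.trans_le h1).ne'
  have hmt : mass S φ ≠ ⊤ := hfin (fun x => ‖φ x‖ ^ 2) (hφ.continuous.norm.pow 2)
    (hφ.compact.comp_left (g := fun z => ‖z‖ ^ 2) (by simp))
  set c : ℝ := ϱ / (mass S φ).toReal with hc
  have hm0' : 0 < (mass S φ).toReal := ENNReal.toReal_pos hm0 hmt
  have hc0 : 0 < c := by positivity
  have hψ : IsTestFunction S fun x => (√c : ℂ) * φ x :=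
    ⟨contDiff_const.mul hφ.smooth, hφ.compact.mul_left,
      (tsupport_mul_subset_right (f := fun _ => (√c : ℂ))).trans hφ.support_subset⟩
  have hψm : mass S (fun x => (√c : ℂ) * φ x) = ENNReal.ofReal ϱ := by
    have h1 : ∀ x, ‖(√c : ℂ) * φ x‖ ^ 2 = c * ‖φ x‖ ^ 2 := fun x => by
      rw [norm_mul, Complex.norm_real, Real.norm_eq_abs, mul_pow, sq_abs, Real.sq_sqrt hc0.le]
    simp only [mass, h1, ENNReal.ofReal_mul hc0.le]
    rw [lintegral_const_mul' _ _ ENNReal.ofReal_ne_top]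
    change _ * mass S φ = _
    rw [← ENNReal.ofReal_toReal hmt, ← ENNReal.ofReal_mul hc0.le, hc, div_mul_cancel₀ _ hm0'.ne']
  have hE : gpFunctional G S (fun x => (√c : ℂ) * φ x)
      (fun j => partialDeriv j fun x => (√c : ℂ) * φ x) ≠ ⊤ := by
    refine hfin _ ?_ ?_
    · have h1 := hψ.continuous
      have h2 := hψ.continuous_partialDeriv
      have h3 : ∀ j, Continuous fun x : Plane => perp x j := by
        intro j
        fin_cases j <;> simp [perp] <;> fun_prop
      refine continuous_const.mul ((continuous_finsetSum _ fun j _ => ?_).add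
        (continuous_const.mul (h1.norm.pow 4)))
      exact ((continuous_const.mul (h2 j)).sub
        ((Complex.continuous_ofReal.comp (h3 j)).mul h1)).norm.pow 2
    · refine HasCompactSupport.intro hψ.compact fun x hx => ?_
      have h1 : (√c : ℂ) * φ x = 0 :=
        image_eq_zero_of_notMem_tsupport (f := fun x => (√c : ℂ) * φ x) hx
      have h2 : ∀ j, partialDeriv j (fun x => (√c : ℂ) * φ x) x = 0 := fun j =>
        IsTestFunction.partialDeriv_eq_zero ⟨hψ.smooth, hψ.compact, subset_rfl⟩ j hx
      simp [h1, h2]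
  have hle := dirichletEnergy_le (G := G) hψ.memH10 hψm
  have : squareEnergyDensity G ϱ 1 = dirichletEnergy G S (ENNReal.ofReal ϱ) := by
    simp [squareEnergyDensity, hS]
  rw [this]
  exact (hle.trans_lt hE.lt_top).ne

theorem tendsto_dirichletEnergy_div {G ϱ e : ℝ} (hϱ : 0 < ϱ) (he0 : 0 ≤ e)
    (he : ⨅ r : Set.Ioi (0 : ℝ), squareEnergyDensity G ϱ r = ENNReal.ofReal e)
    {D : Set Plane} (hD : IsOpen D) (hDb : Bornology.IsBounded D) (hD0 : volume D ≠ 0)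
    (hDf : volume (frontier D) = 0) :
    Tendsto (fun L : ℝ =>
      dirichletEnergy G (L • D) (ENNReal.ofReal ϱ * volume (L • D)) / volume (L • D))
      atTop (𝓝 (ENNReal.ofReal e)) := by
  have hDt : volume D ≠ ⊤ := hDb.measure_lt_top.ne
  refine tendsto_order.2 ⟨fun b' hb' => ?_, fun b hb => ?_⟩
  · obtain ⟨b, hb0, rfl⟩ : ∃ b : ℝ, 0 ≤ b ∧ b' = ENNReal.ofReal b :=
      ⟨b'.toReal, ENNReal.toReal_nonneg, (ENNReal.ofReal_toReal (hb'.trans_le le_top).ne).symm⟩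
    have hbe : b < e := (ENNReal.ofReal_lt_ofReal_iff_of_nonneg hb0).1 hb'
    obtain ⟨R, hR0, hR⟩ : ∃ R : ℝ, 0 < R ∧ closure D ⊆ Metric.ball 0 R :=
      hDb.closure.subset_ball_lt 0 0 |>.imp fun _ h => h
    set a : Plane := WithLp.toLp 2 fun _ => -R with ha
    have hW : closure D ⊆ openSquare a (2 * R) := by
      intro x hx j
      have h1 : ‖x j‖ < R := (PiLp.norm_apply_le x j).trans_lt (by simpa using hR hx)
      rw [Real.norm_eq_abs, abs_lt] at h1
      simp only [ha, Set.mem_Ioo]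
      constructor <;> linarith
    set W := openSquare a (2 * R) with hWdef
    have hWt : volume W ≠ ⊤ := by rw [hWdef, volume_openSquare]; exact ofReal_sq_ne_top _
    set V := W \ closure D with hV
    have hVt : volume V ≠ ⊤ := measure_ne_top_of_subset Set.sdiff_subset hWt
    set v := (volume D).toReal with hv
    set w := (volume V).toReal with hw
    have hv0 : 0 < v := ENNReal.toReal_pos hD0 hDt
    have hw0 : 0 ≤ w := ENNReal.toReal_nonneg
    have hvw : ENNReal.ofReal (v + w) ≤ volume W := by
      rw [ENNReal.ofReal_add hv0.le hw0, ENNReal.ofReal_toReal hDt, ENNReal.ofReal_toReal hVt,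
        ← measure_union (Set.disjoint_left.2 fun x hx hx' => hx'.2 (subset_closure hx))
          ((isOpen_openSquare _ _).sdiff isClosed_closure).measurableSet]
      exact measure_mono (Set.union_subset (subset_closure.trans hW) Set.sdiff_subset)
    -- As s → 0 the left side tends to vb + we, which is below (v + w)e because b < e and v > 0. A
    -- density of at most b on LD would then contradict the bound for the enclosing square.
    obtain ⟨s, hs, hs0⟩ : ∃ s : ℝ, (1 + s) ^ 2 * (v * b + w * (e + s)) < (v + w) * e ∧ 0 < s := by
      have hcont : Tendsto (fun s : ℝ => (1 + s) ^ 2 * (v * b + w * (e + s))) (𝓝[>] 0)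
          (𝓝 ((1 + 0) ^ 2 * (v * b + w * (e + 0)))) :=
        (Continuous.tendsto (by fun_prop) 0).mono_left nhdsWithin_le_nhds
      have hlt : (1 + 0) ^ 2 * (v * b + w * (e + 0)) < (v + w) * e := by nlinarith
      exact ((hcont.eventually_lt_const hlt).and self_mem_nhdsWithin).exists
    obtain ⟨⟨ℓ, hℓ⟩, hsq⟩ : ∃ r : Set.Ioi (0 : ℝ), squareEnergyDensity G ϱ r <
        ENNReal.ofReal (e + s) := by
      rw [← iInf_lt_iff, he]
      exact (ENNReal.ofReal_lt_ofReal_iff (by linarith)).2 (by linarith)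
    filter_upwards [eventually_mul_iInf_squareEnergyDensity_le G hϱ hD hD0 hDf
      (by positivity : 0 < 2 * R) hW hℓ hs0] with L hL
    by_contra hcon
    rw [not_lt] at hcon
    refine hs.not_ge ?_
    rw [← ENNReal.ofReal_le_ofReal_iff (by positivity)]
    rw [ENNReal.ofReal_mul (p := v + w) (by positivity),
      ENNReal.ofReal_mul (p := (1 + s) ^ 2) (by positivity),
      ENNReal.ofReal_add (p := v * b) (by positivity) (by positivity), ENNReal.ofReal_mul hv0.le,
      ENNReal.ofReal_mul hw0, ENNReal.ofReal_toReal hDt, ENNReal.ofReal_toReal hVt]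
    rw [he] at hL
    refine le_trans ?_ (hL.trans ?_)
    · gcongr
    · gcongr
  · rw [← he, gt_iff_lt, iInf_lt_iff] at hb
    obtain ⟨⟨ℓ, hℓ⟩, hsq⟩ := hb
    have hcont : Tendsto (fun s : ℝ => ENNReal.ofReal ((1 + s) ^ 2) * squareEnergyDensity G ϱ ℓ)
        (𝓝[>] 0) (𝓝 (ENNReal.ofReal ((1 + 0) ^ 2) * squareEnergyDensity G ϱ ℓ)) := by
      refine ENNReal.Tendsto.mul_const (ENNReal.tendsto_ofReal ?_) (Or.inl (by simp))
      exact (Continuous.tendsto (by fun_prop) 0).mono_left nhdsWithin_le_nhds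
    obtain ⟨s, hs, hs0⟩ := ((hcont.eventually_lt_const
      (by simpa using hsq)).and self_mem_nhdsWithin).exists
    filter_upwards [eventually_dirichletEnergy_div_le G hϱ hD hD0 hDt hℓ hs0] with L hL
    exact hL.trans_lt hs

theorem tendsto_neumannEnergy_div {G ϱ e : ℝ} (hG : 0 < G) (hϱ : 0 < ϱ)
    {D : Set Plane} (hD : IsOpen D) (hD0 : volume D ≠ 0) (hDt : volume D ≠ ⊤)
    (h : Tendsto (fun L : ℝ =>
      dirichletEnergy G (L • D) (ENNReal.ofReal ϱ * volume (L • D)) / volume (L • D))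
      atTop (𝓝 (ENNReal.ofReal e))) :
    Tendsto (fun L : ℝ =>
      neumannEnergy G (L • D) (ENNReal.ofReal ϱ * volume (L • D)) / volume (L • D))
      atTop (𝓝 (ENNReal.ofReal e)) := by
  refine tendsto_order.2 ⟨fun b' hb' => ?_, fun b hb => ?_⟩
  · obtain ⟨b, hb0, rfl⟩ : ∃ b : ℝ, 0 ≤ b ∧ b' = ENNReal.ofReal b :=
      ⟨b'.toReal, ENNReal.toReal_nonneg, (ENNReal.ofReal_toReal (hb'.trans_le le_top).ne).symm⟩
    have hbe : b < e := (ENNReal.ofReal_lt_ofReal_iff_of_nonneg hb0).1 hb'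
    -- The expression tends to b < e as s → 0. A Neumann density of at most b would therefore force
    -- the Dirichlet density below its limit.
    obtain ⟨s, ⟨hs, hs1⟩, hs0⟩ : ∃ s : ℝ,
        ((1 - s)⁻¹ ^ 2 * ((1 + s) * (b + s) + s) < e ∧ s < 1) ∧ 0 < s := by
      have hcont : Tendsto (fun s : ℝ => (1 - s)⁻¹ ^ 2 * ((1 + s) * (b + s) + s)) (𝓝[>] 0)
          (𝓝 ((1 - 0)⁻¹ ^ 2 * ((1 + 0) * (b + 0) + 0))) := by
        refine Tendsto.mono_left (ContinuousAt.tendsto ?_) nhdsWithin_le_nhds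
        exact ((ContinuousAt.inv₀ (by fun_prop) (by norm_num)).pow 2).mul (by fun_prop)
      exact (((hcont.eventually_lt_const (by simpa using hbe)).and
        (mem_nhdsWithin_of_mem_nhds (Iio_mem_nhds one_pos))).and self_mem_nhdsWithin).exists
    have hlt := (tendsto_order.1 h).1 _
      ((ENNReal.ofReal_lt_ofReal_iff (hb0.trans_lt hbe)).2 hs)
    filter_upwards [hlt, eventually_dirichletEnergy_div_le_of_neumannEnergy hG hϱ hD hD0 hDt hb0
      hs0 hs1] with L hL hN
    by_contra hcon
    exact (hN (not_lt.1 hcon)).not_gt hL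
  · filter_upwards [(tendsto_order.1 h).2 b hb] with L hL
    exact (ENNReal.div_le_div_right (neumannEnergy_le_dirichletEnergy _ _ _) _).trans_lt hL

theorem theorem2p1 (G ϱ : ℝ) (hG : 0 < G) (hϱ : 0 < ϱ) :
    ∃ e : ℝ≥0, ∀ D : Set Plane, IsOpen D → Bornology.IsBounded D → IsSimplyConnected D →
      HasLipschitzBoundary D →
        Tendsto (fun L : ℝ =>
          neumannEnergy G (L • D) (ENNReal.ofReal ϱ * volume (L • D)) / volume (L • D))
          atTop (𝓝 (e : ℝ≥0∞)) ∧
        Tendsto (fun L : ℝ =>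
          dirichletEnergy G (L • D) (ENNReal.ofReal ϱ * volume (L • D)) / volume (L • D))
          atTop (𝓝 (e : ℝ≥0∞)) := by
  set I := ⨅ r : Set.Ioi (0 : ℝ), squareEnergyDensity G ϱ r with hI
  have hIt : I ≠ ⊤ := ne_top_of_le_ne_top (squareEnergyDensity_one_ne_top G hϱ)
    (iInf_le (fun r : Set.Ioi (0 : ℝ) => squareEnergyDensity G ϱ r) ⟨1, Set.mem_Ioi.2 one_pos⟩)
  have hIe : I = ENNReal.ofReal I.toReal := (ENNReal.ofReal_toReal hIt).symm
  refine ⟨I.toNNReal, fun D hD hDb hDs hDl => ?_⟩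
  have hD0 : volume D ≠ 0 := (hD.measure_pos volume hDs.nonempty).ne'
  have hdir := tendsto_dirichletEnergy_div hϱ ENNReal.toReal_nonneg hIe hD hDb hD0
    hDl.volume_frontier
  rw [ENNReal.coe_toNNReal hIt, hIe]
  exact ⟨tendsto_neumannEnergy_div hG hϱ hD hD0 hDb.measure_lt_top.ne hdir, hdir⟩
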